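/- Let $d\ge 1$ and $\omega\in(0,1)$. For a (scalar, vector or matrix valued) function $v\in L^2(\mathbb{R}^d)$ we say that $v$ has decay character $r^*(v)=r$ if $r\in(-\tfrac d2,\infty)$ and the limit $$P_r(v)=\lim_{\rho\to0^+}\rho^{-2r-d}\int_{|\xi|<\rho}|\widehat v(\xi)|^2\,d\xi$$ exists and satisfies $0<P_r(v)<\infty$ (there is at most one such $r$). Let $u_0\in L^2(\mathbb{R}^d;\mathbb{C}^d)$ and $\tau_0\in L^2(\mathbb{R}^d;\mathbb{C}^{d\times d})$ have decay characters $r^*(u_0),\,r^*(\tau_0)\in(-\tfrac d2,\infty)$. (The fields may in particular be real valued, $\tau_0$ symmetric, and $\operatorname{div}u_0=0$, but none of this is required.) Then there exists a constant $C>0$ such that every solution $(u_L,\tau_L)\in C([0,\infty);L^2)$, in the sense of distributions in $x$ for every $t>0$, of the linearized Oldroyd-B system $$\partial_t u-(1-\omega)\Delta u-\mathbb{P}\operatorname{div}\tau=0,\qquad \partial_t\tau+\tau-2\omega D(u)=0,\qquad (u,\tau)(0)=(u_0,\tau_0),$$ satisfies $$\omega\|u_L(t)\|_{L^2}^2+\tfrac12\|\tau_L(t)\|_{L^2}^2\le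 C(1+t)^{-\left(\frac d2+\min\{r^*(u_0),\,1+r^*(\tau_0)\}\right)},\qquad t>0.$$ Here $D(u)=\tfrac12(\nabla u+(\nabla u)^T)$, $(\operatorname{div}\tau)_k=\sum_l\partial_l\tau_{lk}$, $\mathbb{P}$ is the Helmholtz (Leray) projection, i.e. the Fourier multiplier with symbol $\delta_{km}-\xi_k\xi_m/|\xi|^2$, and matrices carry the Frobenius norm. That $(u,\tau)$ solves the system in the sense of distributions in $x$ for every $t>0$ means that, for every complex valued Schwartz function $\varphi$ on $\mathbb{R}^d$ and all $j,k$, the functions $t\mapsto\int u_k(t)\varphi\,dx$ and $t\mapsto\int\tau_{jk}(t)\varphi\,dx$ are differentiable on $(0,\infty)$ with the derivatives obtained from the system by moving all spatial derivatives onto $\varphi$. -/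

import Mathlib

namespace OldroydB

open MeasureTheory Filter Topology SchwartzMap
open scoped FourierTransform LineDeriv Laplacian

noncomputable section

/-- Square integrable vector fields on `ℝ^d` (complex valued, real ones included). -/
abbrev VecL2 (d : ℕ) : Type :=
  Lp (EuclideanSpace ℂ (Fin d)) 2 (volume : Measure (EuclideanSpace ℝ (Fin d)))

/-- Square integrable `d × d` matrix fields on `ℝ^d`, with the Frobenius norm on matrices. -/
abbrev MatL2 (d : ℕ) : Type :=
  Lp (EuclideanSpace ℂ (Fin d × Fin d)) 2 (volume : Measure (EuclideanSpace ℝ (Fin d)))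

/-- `r` is the decay character of the square integrable function `v`: `r > -d/2`, and
`ρ^(-2r-d) ∫_{|ξ| < ρ} |v̂(ξ)|² dξ` has a limit in `(0, ∞)` as `ρ → 0+`. At most one `r` has this
property. (The Fourier transform of Mathlib has the kernel `exp(-2πi x·ξ)`; other
normalizations only change the value of the positive limit.) -/
def IsDecayCharacter {d : ℕ} {F : Type*} [NormedAddCommGroup F] [InnerProductSpace ℂ F]
    [CompleteSpace F] (v : Lp F 2 (volume : Measure (EuclideanSpace ℝ (Fin d)))) (r : ℝ) : Prop :=
  -(d : ℝ) / 2 < r ∧ ∃ P : ℝ, 0 < P ∧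
    Tendsto (fun ρ : ℝ => ρ ^ (-2 * r - (d : ℝ)) *
      ∫ ξ in Metric.ball (0 : EuclideanSpace ℝ (Fin d)) ρ, ‖(𝓕 v) ξ‖ ^ 2) (𝓝[>] 0) (𝓝 P)

/-- The symbol `δ_{km} - ξ_k ξ_m / |ξ|²` of the Helmholtz (Leray) projection. -/
def leraySymbol {d : ℕ} (ξ : EuclideanSpace ℝ (Fin d)) (v : EuclideanSpace ℂ (Fin d)) :
    EuclideanSpace ℂ (Fin d) :=
  WithLp.toLp 2 fun k => v k - (∑ m, (ξ m : ℂ) * v m) / ((‖ξ‖ ^ 2 : ℝ) : ℂ) * (ξ k : ℂ)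

theorem norm_leraySymbol_le {d : ℕ} (ξ : EuclideanSpace ℝ (Fin d))
    (v : EuclideanSpace ℂ (Fin d)) : ‖leraySymbol ξ v‖ ≤ 2 * ‖v‖ := by
  set z : EuclideanSpace ℂ (Fin d) := WithLp.toLp 2 fun k => (ξ k : ℂ) with hz
  have hnz : ‖z‖ = ‖ξ‖ := by
    simp [hz, EuclideanSpace.norm_eq]
  have hin : inner ℂ z v = ∑ m, (ξ m : ℂ) * v m := by
    simp [hz, PiLp.inner_apply, mul_comm]
  have heq : leraySymbol ξ v = v - (inner ℂ z v / ((‖ξ‖ ^ 2 : ℝ) : ℂ)) • z := by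
    ext k
    simp [leraySymbol, hin]
    simp [hz]
  have hsm : ‖(inner ℂ z v / ((‖ξ‖ ^ 2 : ℝ) : ℂ)) • z‖ ≤ ‖v‖ := by
    rw [norm_smul, norm_div, Complex.norm_real, Real.norm_of_nonneg (by positivity), hnz]
    rcases eq_or_lt_of_le (norm_nonneg ξ) with h | h
    · rw [← h]; simp
    · have h1 := norm_inner_le_norm (𝕜 := ℂ) z v
      rw [hnz] at h1
      rw [div_mul_eq_mul_div, div_le_iff₀ (by positivity)]
      nlinarith
  rw [heq]
  linarith [norm_sub_le v ((inner ℂ z v / ((‖ξ‖ ^ 2 : ℝ) : ℂ)) • z)]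

theorem memLp_leraySymbol {d : ℕ} (f : VecL2 d) :
    MemLp (fun ξ => leraySymbol ξ (f ξ)) 2 (volume : Measure (EuclideanSpace ℝ (Fin d))) := by
  refine MemLp.of_le_mul (c := 2) (Lp.memLp f) ?_
    (Eventually.of_forall fun ξ => norm_leraySymbol_le ξ (f ξ))
  have hm : Measurable (fun p : EuclideanSpace ℝ (Fin d) × EuclideanSpace ℂ (Fin d) =>
      leraySymbol p.1 p.2) := by
    unfold leraySymbol
    fun_prop
  exact (hm.comp (measurable_id.prodMk (Lp.stronglyMeasurable f).measurable)).aestronglyMeasurable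

/-- The Helmholtz (Leray) projection `ℙ` of `L²(ℝ^d)^d` onto divergence free fields. -/
def leray {d : ℕ} (f : VecL2 d) : VecL2 d :=
  𝓕⁻ (MemLp.toLp (fun ξ => leraySymbol ξ ((𝓕 f) ξ)) (memLp_leraySymbol (𝓕 f)))

/-- The `l`-th row of a matrix. -/
def rowCLM {d : ℕ} (l : Fin d) :
    EuclideanSpace ℂ (Fin d × Fin d) →L[ℂ] EuclideanSpace ℂ (Fin d) :=
  LinearMap.toContinuousLinearMap
    { toFun := fun A => WithLp.toLp 2 fun k => A (l, k)
      map_add' := fun _ _ => rfl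
      map_smul' := fun _ _ => rfl }

/-- The `l`-th row `(τ_{l1}, …, τ_{ld})` of a matrix field. -/
def row {d : ℕ} (l : Fin d) (τ : MatL2 d) : VecL2 d :=
  (rowCLM l).compLp τ

/-- The partial derivative `∂_l φ` of a Schwartz function. -/
def pd {d : ℕ} (l : Fin d) (φ : 𝓢(EuclideanSpace ℝ (Fin d), ℂ)) :
    𝓢(EuclideanSpace ℝ (Fin d), ℂ) :=
  ∂_{(EuclideanSpace.single l (1 : ℝ) : EuclideanSpace ℝ (Fin d))} φ

/-- `(u, τ)` is a (distributional) solution in `C([0, ∞); L²)` of the linearized Oldroyd-B system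
`∂ₜu - (1 - ω) Δu - ℙ div τ = 0`, `∂ₜτ + τ - 2ω D(u) = 0`, with initial data `(u₀, τ₀)`.
Here `(div τ)_k = ∑_l ∂_l τ_{lk}` and `D(u)_{jk} = (∂_j u_k + ∂_k u_j) / 2`, and all spatial
derivatives are moved to the test function. Since `ℙ` commutes with derivatives,
`ℙ div τ = ∑_l ∂_l (ℙ (row l τ))`, where `row l τ` is square integrable. -/
structure IsSolution {d : ℕ} (ω : ℝ) (u₀ : VecL2 d) (τ₀ : MatL2 d)
    (u : ℝ → VecL2 d) (τ : ℝ → MatL2 d) : Prop where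
  continuousOn_velocity : ContinuousOn u (Set.Ici 0)
  continuousOn_stress : ContinuousOn τ (Set.Ici 0)
  initial_velocity : u 0 = u₀
  initial_stress : τ 0 = τ₀
  velocity_eq : ∀ (φ : 𝓢(EuclideanSpace ℝ (Fin d), ℂ)) (k : Fin d) (t : ℝ), 0 < t →
    HasDerivAt (fun s : ℝ => ∫ x, u s x k * φ x)
      ((1 - ω : ℂ) * (∫ x, u t x k * (Δ φ) x)
        - ∑ l, ∫ x, leray (row l (τ t)) x k * pd l φ x) t
  stress_eq : ∀ (φ : 𝓢(EuclideanSpace ℝ (Fin d), ℂ)) (j k : Fin d) (t : ℝ), 0 < t →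
    HasDerivAt (fun s : ℝ => ∫ x, τ s x (j, k) * φ x)
      (-(∫ x, τ t x (j, k) * φ x)
        - (ω : ℂ) * ((∫ x, u t x k * pd j φ x) + ∫ x, u t x j * pd k φ x)) t

end

end OldroydB

/-!
The Fourier transform turns the system into an ordinary differential equation for each frequency
`ξ`. With `s = 2π|ξ|`, `θ = ξ / |ξ|` and the transverse part `y = P (θ · τ)` of the stress,

  `u' = -(1 - ω) s² u + i s y`,   `τ' = -τ + i ω s (θ ⊗ u + u ⊗ θ)`.

Since solutions are only weak, these equations are not used pointwise in `ξ`. Instead, testing with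
`(1 + |ξ|²)⁻¹ φ` for Schwartz functions `φ` shows that the restriction of `(u, τ)` to a bounded set
of frequencies is differentiable in time in the norm of `L²`
(`hasL2Deriv_of_forall_schwartz`), so that quadratic energies may be differentiated under the
integral sign.

*Low frequencies.* The corrected velocity `v = u + i s y` satisfies
`v' = -s² v + i s³ y + ω s² (θ · v) θ`: it decouples from the stress up to a term of higher order.
Hence `|v|² + s² |τ|²` has dissipation rate at least `(1 - ω) s²` for small `s`
(`lowEnergyRate_le`). Its initial mass in the ball of radius `ρ` is at most a multiple of
`ρ ^ (2 p)` with `p = d / 2 + min ru (1 + rτ)` by the definition of the decay characters; the factor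
`s²` in front of `|τ|²` is what gains the `1` in `1 + rτ`. As this mass does not increase, Fourier
splitting with the radius `ρ² ∼ 1 / t` gives the decay rate `t ^ (-p)` (`le_mul_rpow_of_splitting`,
`IsSolution.lowMass_le`). The stress itself is damped at rate `1` and forced by `v`, so it inherits
the rate (`IsSolution.low_stress_le`).

*High frequencies.* For divergence free `u` and symmetric `τ` the interaction terms cancel in the
energy `ω |u|² + |τ|² / 2`. In general the longitudinal part `θ · u` and the antisymmetric part of
`τ` remain; they satisfy the damped equations `(θ · u)' = -(1 - ω) s² (θ · u)` and `a' = -a`, and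
adding multiples of their squares to the energy absorbs all interaction terms
(`highEnergyRate_le`). The energy above a fixed frequency therefore decays exponentially
(`IsSolution.annulus_energy_le`).
-/

namespace OldroydB

open MeasureTheory Filter Topology SchwartzMap
open scoped FourierTransform LineDeriv Laplacian ComplexConjugate

noncomputable section

/-! ### Comparison principles and differentiation in a Hilbert space -/

/-- A function whose derivative is at most that of `g` wherever it exceeds `g` never overtakes
`g`. -/
theorem le_of_deriv_le_of_lt {f g f' g' : ℝ → ℝ} (hf : ContinuousOn f (Set.Ici 0))
    (hg : ContinuousOn g (Set.Ici 0)) (hf' : ∀ t, 0 < t → HasDerivAt f (f' t) t)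
    (hg' : ∀ t, 0 < t → HasDerivAt g (g' t) t) (h0 : f 0 ≤ g 0)
    (h : ∀ t, 0 < t → g t < f t → f' t ≤ g' t) {t : ℝ} (ht : 0 ≤ t) : f t ≤ g t := by
  by_contra! hlt
  -- after the last time `r ≤ t` with `f r ≤ g r`, the difference `f - g` is antitone
  set A : Set ℝ := {r ∈ Set.Icc 0 t | f r ≤ g r} with hA
  have hcl : IsClosed A :=
    isClosed_Icc.isClosed_le (hf.mono Set.Icc_subset_Ici_self) (hg.mono Set.Icc_subset_Ici_self)
  have hcpt : IsCompact A := isCompact_Icc.of_isClosed_subset hcl (Set.sep_subset _ _)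
  have hne : A.Nonempty := ⟨0, ⟨le_rfl, ht⟩, h0⟩
  have hmem := hcpt.sSup_mem hne
  set r := sSup A with hr
  obtain ⟨⟨hr0, hrt⟩, hfr⟩ := hmem
  have hlast : ∀ x, r < x → x ≤ t → g x < f x := by
    intro x hx hxt
    by_contra! hle
    exact absurd (le_csSup hcpt.bddAbove (show x ∈ A from ⟨⟨hr0.trans hx.le, hxt⟩, hle⟩))
      (not_le.2 hx)
  have hanti : AntitoneOn (fun x => f x - g x) (Set.Icc r t) := by
    apply antitoneOn_of_hasDerivWithinAt_nonpos (convex_Icc r t) (f' := fun x => f' x - g' x)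
    · exact (hf.sub hg).mono fun x hx => hr0.trans hx.1
    · intro x hx
      rw [interior_Icc] at hx
      have hx0 : 0 < x := hr0.trans_lt hx.1
      exact ((hf' x hx0).sub (hg' x hx0)).hasDerivWithinAt
    · intro x hx
      rw [interior_Icc] at hx
      linarith [h x (hr0.trans_lt hx.1) (hlast x hx.1 hx.2.le)]
  have := hanti ⟨le_rfl, hrt⟩ ⟨hrt, le_rfl⟩ hrt
  simp only at this
  linarith

theorem hasDerivAt_mul_add_rpow {K : ℝ} (hK : 0 < K) (L p : ℝ) {t : ℝ} (ht : 0 ≤ t) :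
    HasDerivAt (fun t => L * (K + t) ^ (-p)) (-(p / (K + t) * (L * (K + t) ^ (-p)))) t := by
  have h1 : HasDerivAt (fun t => K + t) 1 t := (hasDerivAt_id t).const_add K
  have hpos : 0 < K + t := by positivity
  have h2 := (h1.rpow_const (p := -p) (Or.inl hpos.ne')).const_mul L
  refine h2.congr_deriv ?_
  rw [Real.rpow_sub_one hpos.ne']
  ring

/-- A quantity damped at rate `c` and forced by a power of time decays like that power. -/
theorem le_mul_rpow_of_deriv_le_damped {M M' : ℝ → ℝ} {c K p B L : ℝ}
    (hM : ContinuousOn M (Set.Ici 0)) (hM' : ∀ t, 0 < t → HasDerivAt M (M' t) t)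
    (hc : 0 < c) (hK : 0 < K) (hL : 0 ≤ L)
    (hineq : ∀ t, 0 < t → M' t ≤ -(c * M t) + B * (K + t) ^ (-p))
    (hcK : 2 * p ≤ c * K) (hB : 2 * B ≤ c * L) (h0 : M 0 ≤ L * K ^ (-p)) {t : ℝ} (ht : 0 ≤ t) :
    M t ≤ L * (K + t) ^ (-p) := by
  refine le_of_deriv_le_of_lt (g := fun t => L * (K + t) ^ (-p)) hM
    (fun t ht => (hasDerivAt_mul_add_rpow hK L p ht).continuousAt.continuousWithinAt) hM'
    (fun t ht => hasDerivAt_mul_add_rpow hK L p ht.le) (by simpa using h0) ?_ ht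
  intro t ht hlt
  have hpos : 0 < K + t := by positivity
  set X := (K + t) ^ (-p) with hX
  have hX0 : 0 < X := Real.rpow_pos_of_pos hpos _
  have h1 := hineq t ht
  have h2 : c * (L * X) ≤ c * M t := by gcongr
  have h3 : 2 * B * X ≤ c * L * X := by gcongr
  have h4 : p / (K + t) ≤ c / 2 := by
    rw [div_le_iff₀ hpos]; nlinarith
  have h5 : p / (K + t) * (L * X) ≤ c / 2 * (L * X) := by gcongr
  nlinarith

/-- Fourier splitting: if the dissipation at time `t` controls, for every small radius `ρ`,
the part of the energy at frequencies above `ρ`, and the part below is at most `B ρ ^ (2 p)`,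
then the energy decays like `t ^ (-p)`. -/
theorem le_mul_rpow_of_splitting {N N' : ℝ → ℝ} {β r K p B L : ℝ}
    (hN : ContinuousOn N (Set.Ici 0)) (hN' : ∀ t, 0 < t → HasDerivAt N (N' t) t)
    (hβ : 0 < β) (hr : 0 < r) (hK : 0 < K) (hp : 0 < p)
    (hineq : ∀ t, 0 < t → ∀ ρ, 0 < ρ → ρ ≤ r →
      N' t ≤ -(β * ρ ^ 2 * (N t - B * ρ ^ (2 * p))))
    (hKr : p + 1 ≤ β * r ^ 2 * K) (hB : (p + 1) * (B * ((p + 1) / β) ^ p) ≤ L)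
    (h0 : N 0 ≤ L * K ^ (-p)) {t : ℝ} (ht : 0 ≤ t) :
    N t ≤ L * (K + t) ^ (-p) := by
  refine le_of_deriv_le_of_lt (g := fun t => L * (K + t) ^ (-p)) hN
    (fun t ht => (hasDerivAt_mul_add_rpow hK L p ht).continuousAt.continuousWithinAt) hN'
    (fun t ht => hasDerivAt_mul_add_rpow hK L p ht.le) (by simpa using h0) ?_ ht
  intro t ht hlt
  have hpos : 0 < K + t := by positivity
  set X := (K + t) ^ (-p) with hX
  have hX0 : 0 < X := Real.rpow_pos_of_pos hpos _
  -- the splitting radius is chosen so that the damping rate is `(p + 1) / (K + t)`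
  set ρ := Real.sqrt ((p + 1) / β / (K + t)) with hρ
  have hρ0 : 0 < ρ := Real.sqrt_pos.2 (by positivity)
  have hρ2 : ρ ^ 2 = (p + 1) / β / (K + t) := Real.sq_sqrt (by positivity)
  have hρr : ρ ≤ r := by
    rw [hρ, Real.sqrt_le_left hr.le, div_div, div_le_iff₀ (by positivity)]
    nlinarith [mul_pos hβ (pow_pos hr 2)]
  have hρp : ρ ^ (2 * p) = ((p + 1) / β) ^ p * X := by
    rw [Real.rpow_mul hρ0.le, Real.rpow_two, hρ2, Real.div_rpow (by positivity) hpos.le, hX,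
      Real.rpow_neg hpos.le, div_eq_mul_inv]
  have h1 := hineq t ht ρ hρ0 hρr
  rw [hρp, hρ2] at h1
  have h2 : β * ((p + 1) / β / (K + t)) = (p + 1) / (K + t) := by field_simp
  rw [h2] at h1
  refine h1.trans ?_
  rw [neg_le_neg_iff, div_mul_eq_mul_div, div_mul_eq_mul_div]
  refine div_le_div_of_nonneg_right ?_ hpos.le
  have h3 : (p + 1) * (B * ((p + 1) / β) ^ p) * X ≤ L * X := by gcongr
  nlinarith

/-- A curve in a Hilbert space that is differentiable with a continuous derivative when tested
against a dense set of vectors is differentiable. -/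
theorem hasDerivAt_of_forall_inner {H : Type*} [NormedAddCommGroup H] [InnerProductSpace ℂ H]
    {D : Set H} (hD : Dense D) {W V : ℝ → H} (hV : ContinuousOn V (Set.Ici 0))
    (h : ∀ φ ∈ D, ∀ t, 0 < t → HasDerivAt (fun s => inner ℂ φ (W s)) (inner ℂ φ (V t)) t)
    {t : ℝ} (ht : 0 < t) : HasDerivAt W (V t) t := by
  rw [hasDerivAt_iff_isLittleO, Asymptotics.isLittleO_iff]
  intro c hc
  have hVt : ContinuousAt V t := hV.continuousAt (Ici_mem_nhds ht)
  obtain ⟨δ, hδ, hball⟩ := Metric.eventually_nhds_iff_ball.1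
    ((Metric.continuousAt_iff'.1 hVt c hc).and (lt_mem_nhds ht))
  filter_upwards [Metric.ball_mem_nhds t hδ] with s hs
  set x := W s - W t - (s - t) • V t with hx
  have key : ∀ φ : H, ‖inner ℂ φ x‖ ≤ c * ‖s - t‖ * ‖φ‖ := by
    intro φ
    refine hD.induction (P := fun φ => ‖inner ℂ φ x‖ ≤ c * ‖s - t‖ * ‖φ‖) ?_
      (isClosed_le (by fun_prop) (by fun_prop)) φ
    intro φ hφ
    have hder : ∀ r ∈ Metric.ball t δ, HasDerivWithinAt
        (fun r => inner ℂ φ (W r) - (r - t) • inner ℂ φ (V t))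
        (inner ℂ φ (V r - V t)) (Metric.ball t δ) r := by
      intro r hr
      have h1 := (h φ hφ r (hball r hr).2).sub
        (((hasDerivAt_id r).sub_const t).smul_const (inner ℂ φ (V t)))
      refine (h1.congr_deriv ?_).hasDerivWithinAt
      rw [inner_sub_right, one_smul]
    have hb : ∀ r ∈ Metric.ball t δ, ‖inner ℂ φ (V r - V t)‖ ≤ c * ‖φ‖ := by
      intro r hr
      have h1 : ‖V r - V t‖ ≤ c := by rw [← dist_eq_norm]; exact (hball r hr).1.le
      calc _ ≤ ‖φ‖ * ‖V r - V t‖ := norm_inner_le_norm _ _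
        _ ≤ c * ‖φ‖ := by rw [mul_comm]; gcongr
    have hmv := (convex_ball t δ).norm_image_sub_le_of_norm_hasDerivWithin_le hder hb
      (Metric.mem_ball_self hδ) hs
    have heq : inner ℂ φ x = inner ℂ φ (W s) - (s - t) • inner ℂ φ (V t)
        - (inner ℂ φ (W t) - (t - t) • inner ℂ φ (V t)) := by
      rw [hx, inner_sub_right, inner_sub_right, inner_smul_right_eq_smul]
      simp; ring
    rw [heq]
    linarith
  have h1 := key x
  rw [inner_self_eq_norm_sq_to_K] at h1
  rcases (norm_nonneg x).eq_or_lt' with h0 | h0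
  · rw [h0]; positivity
  · simp only [norm_pow, RCLike.norm_ofReal, abs_norm] at h1
    nlinarith

/-! ### Curves in `L²` and their energies -/

section

variable {X ι : Type*} [MeasurableSpace X] {μ : Measure X}

/-- `f : [0, ∞) → (X → ℂ)` represents a continuous curve in `L²(μ)`. -/
def IsL2Path (μ : Measure X) (f : ℝ → X → ℂ) : Prop :=
  ∃ F : ℝ → Lp ℂ 2 μ, ContinuousOn F (Set.Ici 0) ∧ ∀ t, 0 ≤ t → F t =ᵐ[μ] f t

/-- `f` represents a curve in `L²(μ)` that is continuous on `[0, ∞)` and differentiable on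
`(0, ∞)` in the norm of `L²(μ)`, with derivative represented by `g`. -/
def HasL2Deriv (μ : Measure X) (f g : ℝ → X → ℂ) : Prop :=
  ∃ F G : ℝ → Lp ℂ 2 μ, ContinuousOn F (Set.Ici 0) ∧ (∀ t, 0 ≤ t → F t =ᵐ[μ] f t) ∧
    ∀ t, 0 < t → G t =ᵐ[μ] g t ∧ HasDerivAt F (G t) t

/-- The energy `∫ e t dμ` of a density `e` is continuous on `[0, ∞)` and differentiable on
`(0, ∞)`, with derivative `∫ e' t dμ`. -/
structure HasEnergyDeriv (μ : Measure X) (e e' : ℝ → X → ℝ) : Prop where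
  integrable : ∀ t, 0 ≤ t → Integrable (e t) μ
  integrable_deriv : ∀ t, 0 < t → Integrable (e' t) μ
  continuousOn : ContinuousOn (fun t => ∫ x, e t x ∂μ) (Set.Ici 0)
  hasDerivAt : ∀ t, 0 < t → HasDerivAt (fun t => ∫ x, e t x ∂μ) (∫ x, e' t x ∂μ) t

/-- Multiplication by a bounded function is a bounded operator on `L²`. -/
theorem exists_mul_clm {c : X → ℂ} {C : ℝ} (hc : AEStronglyMeasurable c μ)
    (hC : ∀ᵐ x ∂μ, ‖c x‖ ≤ C) :
    ∃ A : Lp ℂ 2 μ →L[ℂ] Lp ℂ 2 μ, ∀ f : Lp ℂ 2 μ, A f =ᵐ[μ] fun x => c x * f x := by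
  have hm : MemLp c ⊤ μ := memLp_top_of_bound hc C hC
  refine ⟨(ContinuousLinearMap.mul ℂ ℂ).holderL μ ⊤ 2 2 hm.toLp, fun f => ?_⟩
  filter_upwards [(ContinuousLinearMap.mul ℂ ℂ).coeFn_holder (r := 2) hm.toLp f, hm.coeFn_toLp]
    with x hx hx'
  rw [← hx']
  exact hx

namespace IsL2Path

theorem add {f₁ f₂ : ℝ → X → ℂ} (h₁ : IsL2Path μ f₁) (h₂ : IsL2Path μ f₂) :
    IsL2Path μ (fun t x => f₁ t x + f₂ t x) := by
  obtain ⟨F₁, hc₁, he₁⟩ := h₁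
  obtain ⟨F₂, hc₂, he₂⟩ := h₂
  refine ⟨fun t => F₁ t + F₂ t, hc₁.add hc₂, fun t ht => ?_⟩
  filter_upwards [Lp.coeFn_add (F₁ t) (F₂ t), he₁ t ht, he₂ t ht] with x h h1 h2
  rw [h, Pi.add_apply, h1, h2]

theorem const_mul {f : ℝ → X → ℂ} (h : IsL2Path μ f) {c : X → ℂ} {C : ℝ}
    (hc : AEStronglyMeasurable c μ) (hC : ∀ᵐ x ∂μ, ‖c x‖ ≤ C) :
    IsL2Path μ (fun t x => c x * f t x) := by
  obtain ⟨F, hcF, he⟩ := h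
  obtain ⟨A, hA⟩ := exists_mul_clm hc hC
  refine ⟨fun t => A (F t), A.continuous.comp_continuousOn hcF, fun t ht => ?_⟩
  filter_upwards [hA (F t), he t ht] with x h h1
  rw [h, h1]

theorem sum (s : Finset ι) {f : ι → ℝ → X → ℂ} (h : ∀ i ∈ s, IsL2Path μ (f i)) :
    IsL2Path μ (fun t x => ∑ i ∈ s, f i t x) := by
  classical
  induction s using Finset.induction_on with
  | empty => exact ⟨fun _ => 0, continuousOn_const, fun t _ => by
      simp only [Finset.sum_empty]; exact Lp.coeFn_zero ℂ 2 μ⟩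
  | insert i s hi ih =>
    simp only [Finset.sum_insert hi]
    exact (h i (Finset.mem_insert_self i s)).add
      (ih fun j hj => h j (Finset.mem_insert_of_mem hj))

end IsL2Path

namespace HasL2Deriv

theorem add {f₁ f₂ g₁ g₂ : ℝ → X → ℂ} (h₁ : HasL2Deriv μ f₁ g₁) (h₂ : HasL2Deriv μ f₂ g₂) :
    HasL2Deriv μ (fun t x => f₁ t x + f₂ t x) (fun t x => g₁ t x + g₂ t x) := by
  obtain ⟨F₁, G₁, hc₁, he₁, hd₁⟩ := h₁
  obtain ⟨F₂, G₂, hc₂, he₂, hd₂⟩ := h₂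
  refine ⟨fun t => F₁ t + F₂ t, fun t => G₁ t + G₂ t, hc₁.add hc₂, fun t ht => ?_,
    fun t ht => ⟨?_, (hd₁ t ht).2.add (hd₂ t ht).2⟩⟩
  · filter_upwards [Lp.coeFn_add (F₁ t) (F₂ t), he₁ t ht, he₂ t ht] with x h h1 h2
    rw [h, Pi.add_apply, h1, h2]
  · filter_upwards [Lp.coeFn_add (G₁ t) (G₂ t), (hd₁ t ht).1, (hd₂ t ht).1] with x h h1 h2
    rw [h, Pi.add_apply, h1, h2]

theorem const_mul {f g : ℝ → X → ℂ} (h : HasL2Deriv μ f g) {c : X → ℂ} {C : ℝ}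
    (hc : AEStronglyMeasurable c μ) (hC : ∀ᵐ x ∂μ, ‖c x‖ ≤ C) :
    HasL2Deriv μ (fun t x => c x * f t x) (fun t x => c x * g t x) := by
  obtain ⟨F, G, hcF, he, hd⟩ := h
  obtain ⟨A, hA⟩ := exists_mul_clm hc hC
  refine ⟨fun t => A (F t), fun t => A (G t), A.continuous.comp_continuousOn hcF,
    fun t ht => ?_, fun t ht => ⟨?_, ?_⟩⟩
  · filter_upwards [hA (F t), he t ht] with x h h1
    rw [h, h1]
  · filter_upwards [hA (G t), (hd t ht).1] with x h h1
    rw [h, h1]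
  · exact (A.restrictScalars ℝ).hasFDerivAt.comp_hasDerivAt t (hd t ht).2

theorem sum (s : Finset ι) {f g : ι → ℝ → X → ℂ} (h : ∀ i ∈ s, HasL2Deriv μ (f i) (g i)) :
    HasL2Deriv μ (fun t x => ∑ i ∈ s, f i t x) (fun t x => ∑ i ∈ s, g i t x) := by
  classical
  induction s using Finset.induction_on with
  | empty => exact ⟨fun _ => 0, fun _ => 0, continuousOn_const, fun t _ => by
      simp only [Finset.sum_empty]; exact Lp.coeFn_zero ℂ 2 μ, fun t _ => ⟨by
      simp only [Finset.sum_empty]; exact Lp.coeFn_zero ℂ 2 μ, hasDerivAt_const t 0⟩⟩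
  | insert i s hi ih =>
    simp only [Finset.sum_insert hi]
    exact (h i (Finset.mem_insert_self i s)).add
      (ih fun j hj => h j (Finset.mem_insert_of_mem hj))

theorem hasEnergyDeriv {f g : ℝ → X → ℂ} (h : HasL2Deriv μ f g) :
    HasEnergyDeriv μ (fun t x => ‖f t x‖ ^ 2)
      (fun t x => 2 * (conj (f t x) * g t x).re) := by
  obtain ⟨F, G, hcF, he, hd⟩ := h
  have hint : ∀ t, 0 ≤ t → ∫ x, ‖f t x‖ ^ 2 ∂μ = ‖F t‖ ^ 2 := by
    intro t ht
    rw [← inner_self_eq_norm_sq (𝕜 := ℂ), L2.inner_def, ← integral_re (L2.integrable_inner _ _)]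
    refine integral_congr_ae ?_
    filter_upwards [he t ht] with x hx
    rw [inner_self_eq_norm_sq (𝕜 := ℂ), hx]
  have hae : ∀ t, 0 < t → (fun x => RCLike.re (inner ℂ (F t x) (G t x))) =ᵐ[μ]
      fun x => (conj (f t x) * g t x).re := by
    intro t ht
    filter_upwards [he t ht.le, (hd t ht).1] with x h1 h2
    rw [h1, h2, RCLike.inner_apply, mul_comm]
    rfl
  refine ⟨fun t ht => ?_, fun t ht => ?_, ?_, fun t ht => ?_⟩
  · have := ((Lp.memLp (F t)).ae_eq (he t ht)).integrable_norm_pow (p := 2) (by norm_num)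
    exact this
  · exact (((L2.integrable_inner (𝕜 := ℂ) (F t) (G t)).re).congr (hae t ht)).const_mul 2
  · exact (hcF.norm.pow 2).congr fun t ht => hint t ht
  · have h1 : HasDerivAt (fun t => ‖F t‖ ^ 2) (2 * RCLike.re (inner ℂ (F t) (G t))) t := by
      have h2 := (hd t ht).2.inner ℂ (hd t ht).2
      have h3 := (RCLike.reCLM (K := ℂ)).hasFDerivAt.comp_hasDerivAt t h2
      have h4 : (fun t => ‖F t‖ ^ 2) = (RCLike.reCLM (K := ℂ)) ∘ fun t => inner ℂ (F t) (F t) := by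
        ext s
        exact (inner_self_eq_norm_sq (𝕜 := ℂ) (F s)).symm
      rw [h4]
      refine h3.congr_deriv ?_
      rw [RCLike.reCLM_apply, map_add, inner_re_symm (𝕜 := ℂ) (G t) (F t)]
      ring
    have h5 : 2 * RCLike.re (inner ℂ (F t) (G t)) = ∫ x, 2 * (conj (f t x) * g t x).re ∂μ := by
      rw [integral_const_mul, ← integral_congr_ae (hae t ht),
        integral_re (L2.integrable_inner _ _), L2.inner_def]
    rw [← h5]
    refine h1.congr_of_eventuallyEq ?_
    filter_upwards [lt_mem_nhds ht] with s hs using hint s hs.le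

end HasL2Deriv

namespace HasEnergyDeriv

theorem add {e₁ e₂ e₁' e₂' : ℝ → X → ℝ} (h₁ : HasEnergyDeriv μ e₁ e₁')
    (h₂ : HasEnergyDeriv μ e₂ e₂') :
    HasEnergyDeriv μ (fun t x => e₁ t x + e₂ t x) (fun t x => e₁' t x + e₂' t x) where
  integrable t ht := (h₁.integrable t ht).add (h₂.integrable t ht)
  integrable_deriv t ht := (h₁.integrable_deriv t ht).add (h₂.integrable_deriv t ht)
  continuousOn := (h₁.continuousOn.add h₂.continuousOn).congr fun t ht =>
    integral_add (h₁.integrable t ht) (h₂.integrable t ht)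
  hasDerivAt t ht := by
    rw [integral_add (h₁.integrable_deriv t ht) (h₂.integrable_deriv t ht)]
    refine ((h₁.hasDerivAt t ht).add (h₂.hasDerivAt t ht)).congr_of_eventuallyEq ?_
    filter_upwards [lt_mem_nhds ht] with s hs
    exact integral_add (h₁.integrable s hs.le) (h₂.integrable s hs.le)

theorem const_mul {e e' : ℝ → X → ℝ} (h : HasEnergyDeriv μ e e') (c : ℝ) :
    HasEnergyDeriv μ (fun t x => c * e t x) (fun t x => c * e' t x) where
  integrable t ht := (h.integrable t ht).const_mul c
  integrable_deriv t ht := (h.integrable_deriv t ht).const_mul c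
  continuousOn := by
    simp only [integral_const_mul]
    exact continuousOn_const.mul h.continuousOn
  hasDerivAt t ht := by
    simp only [integral_const_mul]
    exact (h.hasDerivAt t ht).const_mul c

theorem sum (s : Finset ι) {e e' : ι → ℝ → X → ℝ} (h : ∀ i ∈ s, HasEnergyDeriv μ (e i) (e' i)) :
    HasEnergyDeriv μ (fun t x => ∑ i ∈ s, e i t x) (fun t x => ∑ i ∈ s, e' i t x) := by
  classical
  induction s using Finset.induction_on with
  | empty =>
    simp only [Finset.sum_empty]
    exact ⟨fun _ _ => integrable_zero _ _ _, fun _ _ => integrable_zero _ _ _, by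
      simp only [integral_zero]; exact continuousOn_const, fun t _ => by
      simp only [integral_zero]; exact hasDerivAt_const t 0⟩
  | insert i s hi ih =>
    simp only [Finset.sum_insert hi]
    exact (h i (Finset.mem_insert_self i s)).add
      (ih fun j hj => h j (Finset.mem_insert_of_mem hj))

end HasEnergyDeriv

end

section Weak

theorem continuous_weight {E : Type*} [NormedAddCommGroup E] :
    Continuous fun ξ : E => (((1 + ‖ξ‖ ^ 2)⁻¹ : ℝ) : ℂ) := by
  refine Complex.continuous_ofReal.comp (Continuous.inv₀ (by fun_prop) fun ξ => ?_)
  positivity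

/-- A Schwartz function `ψ` with `∫ f ψ = ⟪φ, (1 + |ξ|²)⁻¹ f⟫` for all `f`. -/
theorem exists_schwartz_weight {E : Type*} [NormedAddCommGroup E] [InnerProductSpace ℝ E]
    (φ : 𝓢(E, ℂ)) :
    ∃ ψ : 𝓢(E, ℂ), ∀ x, ψ x = (((1 + ‖x‖ ^ 2)⁻¹ : ℝ) : ℂ) * conj (φ x) := by
  have hg := Function.hasTemperateGrowth_one_add_norm_sq_rpow E (-1)
  refine ⟨smulLeftCLM ℂ (fun x : E => (1 + ‖x‖ ^ 2) ^ (-1 : ℝ))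
    (postcompCLM (Complex.conjCLE : ℂ →L[ℝ] ℂ) φ), fun x => ?_⟩
  rw [smulLeftCLM_apply_apply hg, Real.rpow_neg_one]
  simp [Complex.real_smul]

variable {E : Type*} [NormedAddCommGroup E] [InnerProductSpace ℝ E] [FiniteDimensional ℝ E]
  [MeasurableSpace E] [BorelSpace E]

theorem dense_range_toLp : Dense (Set.range fun φ : 𝓢(E, ℂ) => φ.toLp 2 (volume : Measure E)) :=
  SchwartzMap.denseRange_toLpCLM (F := ℂ) (p := 2) ENNReal.ofNat_ne_top

/-- If `f` satisfies `∂ₜ f = g` when tested against Schwartz functions, where `g` grows at most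
quadratically with respect to square integrable functions, then `f` is strongly differentiable in
`L²(S)` for every bounded set `S`. -/
theorem hasL2Deriv_of_forall_schwartz {f g : ℝ → E → ℂ} (hf : IsL2Path volume f)
    (hg : IsL2Path volume fun t ξ => (((1 + ‖ξ‖ ^ 2)⁻¹ : ℝ) : ℂ) * g t ξ)
    (h : ∀ (φ : 𝓢(E, ℂ)) (t : ℝ), 0 < t →
      HasDerivAt (fun s => ∫ ξ, f s ξ * φ ξ) (∫ ξ, g t ξ * φ ξ) t)
    {S : Set E} (hS : MeasurableSet S) {R : ℝ} (hR : ∀ ξ ∈ S, ‖ξ‖ ≤ R) :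
    HasL2Deriv (volume.restrict S) f g := by
  obtain ⟨F, hcF, hF⟩ := hf
  obtain ⟨G, hcG, hG⟩ := hg
  obtain ⟨A, hA⟩ := exists_mul_clm (μ := (volume : Measure E)) (C := 1) continuous_weight.aestronglyMeasurable
    (Eventually.of_forall fun ξ => by
      rw [Complex.norm_real, Real.norm_of_nonneg (by positivity)]
      exact inv_le_one_of_one_le₀ (by nlinarith [sq_nonneg ‖ξ‖]))
  have hder : ∀ t, 0 < t → HasDerivAt (fun t => A (F t)) (G t) t := by
    intro t ht
    refine hasDerivAt_of_forall_inner dense_range_toLp hcG ?_ ht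
    rintro _ ⟨φ, rfl⟩ t ht
    obtain ⟨ψ, hψ⟩ := exists_schwartz_weight φ
    have h1 : inner ℂ (φ.toLp 2 (volume : Measure E)) (G t) = ∫ ξ, g t ξ * ψ ξ := by
      rw [L2.inner_def]
      refine integral_congr_ae ?_
      filter_upwards [φ.coeFn_toLp 2 volume, hG t ht.le] with ξ h1 h2
      rw [h1, h2, hψ, RCLike.inner_apply]
      ring
    rw [h1]
    refine (h ψ t ht).congr_of_eventuallyEq ?_
    filter_upwards [lt_mem_nhds ht] with s hs
    rw [L2.inner_def]
    refine integral_congr_ae ?_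
    filter_upwards [φ.coeFn_toLp 2 volume, hF s hs.le, hA (F s)] with ξ h1 h2 h3
    rw [h1, h3, h2, hψ, RCLike.inner_apply]
    ring
  -- on `S` the weight `(1 + |ξ|²)⁻¹` is bounded below and can be divided out
  have hw : HasL2Deriv (volume.restrict S) (fun t ξ => (((1 + ‖ξ‖ ^ 2)⁻¹ : ℝ) : ℂ) * f t ξ)
      (fun t ξ => (((1 + ‖ξ‖ ^ 2)⁻¹ : ℝ) : ℂ) * g t ξ) := by
    set Rs := LpToLpRestrictCLM E ℂ ℂ volume 2 S with hRs
    refine ⟨fun t => Rs (A (F t)), fun t => Rs (G t),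
      Rs.continuous.comp_continuousOn (A.continuous.comp_continuousOn hcF), fun t ht => ?_,
      fun t ht => ⟨?_, ?_⟩⟩
    · filter_upwards [LpToLpRestrictCLM_coeFn ℂ S (A (F t)), ae_restrict_of_ae (hA (F t)),
        ae_restrict_of_ae (hF t ht)] with ξ h1 h2 h3
      rw [h1, h2, h3]
    · filter_upwards [LpToLpRestrictCLM_coeFn ℂ S (G t), ae_restrict_of_ae (hG t ht.le)]
        with ξ h1 h2
      rw [h1, h2]
    · exact (Rs.restrictScalars ℝ).hasFDerivAt.comp_hasDerivAt t (hder t ht)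
  have hfin := hw.const_mul (c := fun ξ : E => ((1 + ‖ξ‖ ^ 2 : ℝ) : ℂ)) (C := 1 + R ^ 2)
    (by fun_prop) (by
      filter_upwards [ae_restrict_mem hS] with ξ hξ
      rw [Complex.norm_real, Real.norm_of_nonneg (by positivity)]
      nlinarith [hR ξ hξ, norm_nonneg ξ])
  have hcancel : ∀ (ξ : E) (z : ℂ),
      ((1 + ‖ξ‖ ^ 2 : ℝ) : ℂ) * ((((1 + ‖ξ‖ ^ 2)⁻¹ : ℝ) : ℂ) * z) = z := by
    intro ξ z
    rw [← mul_assoc, ← Complex.ofReal_mul, mul_inv_cancel₀ (by positivity), Complex.ofReal_one,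
      one_mul]
  simpa only [hcancel] using hfin

end Weak

/-! ### The system in frequency space -/

variable {d : ℕ}

section Symbols

/-- The direction `ξ / |ξ|` of a frequency; it is `0` for `ξ = 0`. -/
def dir (ξ : EuclideanSpace ℝ (Fin d)) (k : Fin d) : ℝ := ξ k / ‖ξ‖

/-- The angular wave number `2π|ξ|`. -/
def wave (ξ : EuclideanSpace ℝ (Fin d)) : ℝ := 2 * Real.pi * ‖ξ‖

/-- The vector `P (θ · A)`, where `P = 1 - θ ⊗ θ` acts on the rows of the matrix `A`. -/
def transverse (θ : Fin d → ℝ) (A : Fin d → Fin d → ℂ) (k : Fin d) : ℂ :=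
  ∑ l, (θ l : ℂ) * (A l k - θ k * ∑ m, (θ m : ℂ) * A l m)

/-- The time derivative of the velocity at a frequency of direction `θ` and wave number `s`. -/
def velRate (ω s : ℝ) (θ : Fin d → ℝ) (u : Fin d → ℂ) (A : Fin d → Fin d → ℂ) (k : Fin d) : ℂ :=
  -(((1 - ω) * s ^ 2 : ℝ) : ℂ) * u k + Complex.I * s * transverse θ A k

/-- The time derivative of the stress at a frequency of direction `θ` and wave number `s`. -/
def stressRate (ω s : ℝ) (θ : Fin d → ℝ) (u : Fin d → ℂ) (A : Fin d → Fin d → ℂ)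
    (j k : Fin d) : ℂ :=
  -A j k + Complex.I * ((ω * s : ℝ) : ℂ) * (θ j * u k + θ k * u j)

theorem wave_mul_dir (ξ : EuclideanSpace ℝ (Fin d)) (k : Fin d) :
    wave ξ * dir ξ k = 2 * Real.pi * ξ k := by
  rcases eq_or_ne ξ 0 with rfl | h
  · simp [wave]
  · rw [wave, dir]
    field_simp [norm_ne_zero_iff.2 h]

theorem abs_dir_le (ξ : EuclideanSpace ℝ (Fin d)) (k : Fin d) : |dir ξ k| ≤ 1 := by
  rw [dir, abs_div, abs_norm]
  exact div_le_one_of_le₀ (PiLp.norm_apply_le ξ k) (norm_nonneg _)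

theorem norm_dir_le (ξ : EuclideanSpace ℝ (Fin d)) (k : Fin d) : ‖(dir ξ k : ℂ)‖ ≤ 1 := by
  rw [Complex.norm_real]
  exact abs_dir_le ξ k

theorem measurable_dir (k : Fin d) :
    Measurable fun ξ : EuclideanSpace ℝ (Fin d) => (dir ξ k : ℂ) := by
  unfold dir
  fun_prop

theorem leraySymbol_apply (ξ : EuclideanSpace ℝ (Fin d)) (v : EuclideanSpace ℂ (Fin d))
    (k : Fin d) : leraySymbol ξ v k = v k - dir ξ k * ∑ m, (dir ξ m : ℂ) * v m := by
  simp only [leraySymbol, dir, Complex.ofReal_div, Complex.ofReal_pow, div_mul_eq_mul_div,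
    ← Finset.sum_div]
  ring

end Symbols

section Paths

variable {μ : Measure (EuclideanSpace ℝ (Fin d))}

theorem IsL2Path.transverse {A : Fin d → Fin d → ℝ → EuclideanSpace ℝ (Fin d) → ℂ}
    (h : ∀ j k, IsL2Path μ (A j k)) (k : Fin d) :
    IsL2Path μ fun t ξ => OldroydB.transverse (dir ξ) (fun j k => A j k t ξ) k := by
  have hm : ∀ i : Fin d, AEStronglyMeasurable (fun ξ => (dir ξ i : ℂ)) μ :=
    fun i => (measurable_dir i).aestronglyMeasurable
  have hb : ∀ i : Fin d, ∀ᵐ ξ ∂μ, ‖(dir ξ i : ℂ)‖ ≤ 1 :=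
    fun i => Eventually.of_forall fun ξ => norm_dir_le ξ i
  have := IsL2Path.sum Finset.univ fun l _ => ((h l k).add ((IsL2Path.sum Finset.univ fun m _ =>
    (h l m).const_mul (hm m) (hb m)).const_mul (c := fun ξ => -(dir ξ k : ℂ)) (hm k).neg
      (by simpa using hb k))).const_mul (hm l) (hb l)
  simpa only [OldroydB.transverse, sub_eq_add_neg, neg_mul] using this

theorem HasL2Deriv.transverse {A B : Fin d → Fin d → ℝ → EuclideanSpace ℝ (Fin d) → ℂ}
    (h : ∀ j k, HasL2Deriv μ (A j k) (B j k)) (k : Fin d) :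
    HasL2Deriv μ (fun t ξ => OldroydB.transverse (dir ξ) (fun j k => A j k t ξ) k)
      (fun t ξ => OldroydB.transverse (dir ξ) (fun j k => B j k t ξ) k) := by
  have hm : ∀ i : Fin d, AEStronglyMeasurable (fun ξ => (dir ξ i : ℂ)) μ :=
    fun i => (measurable_dir i).aestronglyMeasurable
  have hb : ∀ i : Fin d, ∀ᵐ ξ ∂μ, ‖(dir ξ i : ℂ)‖ ≤ 1 :=
    fun i => Eventually.of_forall fun ξ => norm_dir_le ξ i
  have := HasL2Deriv.sum Finset.univ fun l _ =>
    ((h l k).add ((HasL2Deriv.sum Finset.univ fun m _ =>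
      (h l m).const_mul (hm m) (hb m)).const_mul (c := fun ξ => -(dir ξ k : ℂ)) (hm k).neg
        (by simpa using hb k))).const_mul (hm l) (hb l)
  simpa only [OldroydB.transverse, sub_eq_add_neg, neg_mul] using this

theorem isL2Path_coord {ι : Type*} [Fintype ι]
    {f : ℝ → Lp (EuclideanSpace ℂ ι) 2 (volume : Measure (EuclideanSpace ℝ (Fin d)))}
    (hf : ContinuousOn f (Set.Ici 0)) (i : ι) :
    IsL2Path volume fun t ξ => (𝓕 (f t)) ξ i := by
  set P := (EuclideanSpace.proj i : EuclideanSpace ℂ ι →L[ℂ] ℂ) with hP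
  refine ⟨fun t => P.compLpL 2 volume (𝓕 (f t)), ?_, fun t _ => ?_⟩
  · exact (P.compLpL 2 volume).continuous.comp_continuousOn
      ((Lp.fourierTransformₗᵢ _ _).continuous.comp_continuousOn hf)
  · exact P.coeFn_compLpL _

end Paths

section Fourier

variable {ι : Type*} [Fintype ι]

theorem integrable_coord_mul (f : Lp (EuclideanSpace ℂ ι) 2
    (volume : Measure (EuclideanSpace ℝ (Fin d)))) (i : ι) (φ : 𝓢(EuclideanSpace ℝ (Fin d), ℂ)) :
    Integrable fun x => f x i * φ x := by
  have h1 : MemLp (fun x => f x i) 2 volume :=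
    ((EuclideanSpace.proj i : EuclideanSpace ℂ ι →L[ℂ] ℂ).comp_memLp f)
  exact h1.integrable_mul (φ.memLp 2 volume)

/-- The Fourier transform of a square integrable field can be moved to the test function. -/
theorem integral_coord_mul_fourier (f : Lp (EuclideanSpace ℂ ι) 2
    (volume : Measure (EuclideanSpace ℝ (Fin d)))) (i : ι) (ψ : 𝓢(EuclideanSpace ℝ (Fin d), ℂ)) :
    ∫ x, f x i * (𝓕 ψ) x = ∫ ξ, (𝓕 f) ξ i * ψ ξ := by
  have hcoord : ∀ (g : Lp (EuclideanSpace ℂ ι) 2 (volume : Measure (EuclideanSpace ℝ (Fin d))))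
      (φ : 𝓢(EuclideanSpace ℝ (Fin d), ℂ)), (∫ x, φ x • g x) i = ∫ x, g x i * φ x := by
    intro g φ
    have hint : Integrable fun x => φ x • g x :=
      memLp_one_iff_integrable.1 ((Lp.memLp g).smul (φ.memLp 2 volume))
    have := (EuclideanSpace.proj i : EuclideanSpace ℂ ι →L[ℂ] ℂ).integral_comp_comm hint
    simp only [PiLp.proj_apply, PiLp.smul_apply, smul_eq_mul] at this
    rw [← this]
    simp only [mul_comm]
  have h := congrArg (fun T => T ψ) (Lp.fourier_toTemperedDistribution_eq f)
  simp only [TemperedDistribution.fourier_apply, Lp.toTemperedDistribution_apply] at h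
  rw [← hcoord, ← hcoord, h]

/-- A derivative of `𝓕 ψ` is the Fourier transform of `-2πi ξ_l ψ`. -/
theorem pd_fourier (l : Fin d) (ψ : 𝓢(EuclideanSpace ℝ (Fin d), ℂ)) :
    ∃ χ : 𝓢(EuclideanSpace ℝ (Fin d), ℂ), pd l (𝓕 ψ) = 𝓕 χ ∧
      ∀ ξ, χ ξ = -(2 * Real.pi * Complex.I * (ξ l : ℂ)) * ψ ξ := by
  refine ⟨_, SchwartzMap.lineDerivOp_fourier_eq ψ _, fun ξ => ?_⟩
  have : (inner ℝ · (EuclideanSpace.single l (1 : ℝ) :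
      EuclideanSpace ℝ (Fin d))).HasTemperateGrowth := by fun_prop
  change -(2 * (Real.pi : ℂ) * Complex.I) • (smulLeftCLM ℂ (inner ℝ · (EuclideanSpace.single l
    (1 : ℝ) : EuclideanSpace ℝ (Fin d))) ψ) ξ = _
  rw [smulLeftCLM_apply_apply this, EuclideanSpace.inner_single_right, conj_trivial, one_mul,
    Complex.real_smul, smul_eq_mul]
  ring

/-- The Laplacian of `𝓕 ψ` is the Fourier transform of `-(2π|ξ|)² ψ`. -/
theorem laplacian_fourier (ψ : 𝓢(EuclideanSpace ℝ (Fin d), ℂ)) :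
    ∃ χ : 𝓢(EuclideanSpace ℝ (Fin d), ℂ), Δ (𝓕 ψ) = 𝓕 χ ∧
      ∀ ξ, χ ξ = -((wave ξ ^ 2 : ℝ) : ℂ) * ψ ξ := by
  choose χ₁ h₁ h₁' using fun l => pd_fourier l ψ
  choose χ₂ h₂ h₂' using fun l => pd_fourier l (χ₁ l)
  refine ⟨∑ l, χ₂ l, ?_, fun ξ => ?_⟩
  · rw [SchwartzMap.laplacian_eq_sum (EuclideanSpace.basisFun (Fin d) ℝ)]
    have : ∀ l, ∂_{(EuclideanSpace.basisFun (Fin d) ℝ) l}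
        (∂_{(EuclideanSpace.basisFun (Fin d) ℝ) l} (𝓕 ψ)) = 𝓕 (χ₂ l) := by
      intro l
      rw [← h₂, ← h₁, EuclideanSpace.basisFun_apply]
      rfl
    simp only [this]
    exact (map_sum (FourierTransform.fourierEquiv ℂ 𝓢(EuclideanSpace ℝ (Fin d), ℂ)) χ₂ Finset.univ).symm
  · have h3 : (∑ l, χ₂ l) ξ = ∑ l, χ₂ l ξ := by simp
    rw [h3]
    simp only [h₂', h₁']
    rw [wave, mul_pow, EuclideanSpace.real_norm_sq_eq]
    push_cast
    rw [Finset.mul_sum, ← Finset.sum_neg_distrib, Finset.sum_mul]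
    refine Finset.sum_congr rfl fun l _ => ?_
    linear_combination (4 * Real.pi ^ 2 * (ξ l : ℂ) ^ 2 * ψ ξ) * Complex.I_sq

theorem ae_eq_of_forall_integral_mul_schwartz {f g : EuclideanSpace ℝ (Fin d) → ℂ}
    (hf : MemLp f 2 volume) (hg : MemLp g 2 volume)
    (h : ∀ φ : 𝓢(EuclideanSpace ℝ (Fin d), ℂ), ∫ x, f x * φ x = ∫ x, g x * φ x) :
    f =ᵐ[volume] g := by
  have key : hf.toLp = hg.toLp := by
    refine dense_range_toLp.eq_of_inner_right ℂ ?_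
    rintro _ ⟨φ, rfl⟩
    have hφ := h (postcompCLM (Complex.conjCLE : ℂ →L[ℝ] ℂ) φ)
    rw [L2.inner_def, L2.inner_def]
    calc _ = ∫ x, f x * (postcompCLM (Complex.conjCLE : ℂ →L[ℝ] ℂ) φ) x := by
          refine integral_congr_ae ?_
          filter_upwards [φ.coeFn_toLp 2 volume, hf.coeFn_toLp] with x h1 h2
          rw [h1, h2, RCLike.inner_apply]
          rfl
      _ = _ := by
          rw [hφ]
          refine integral_congr_ae ?_
          filter_upwards [φ.coeFn_toLp 2 volume, hg.coeFn_toLp] with x h1 h2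
          rw [h1, h2, RCLike.inner_apply]
          rfl
  exact hf.coeFn_toLp.symm.trans (key ▸ hg.coeFn_toLp)

theorem memLp_coord (f : Lp (EuclideanSpace ℂ ι) 2
    (volume : Measure (EuclideanSpace ℝ (Fin d)))) (i : ι) : MemLp (fun x => f x i) 2 volume :=
  (EuclideanSpace.proj i : EuclideanSpace ℂ ι →L[ℂ] ℂ).comp_memLp f

theorem fourier_row_ae (τ : MatL2 d) (l k : Fin d) :
    (fun ξ => (𝓕 (row l τ)) ξ k) =ᵐ[volume] fun ξ => (𝓕 τ) ξ (l, k) := by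
  refine ae_eq_of_forall_integral_mul_schwartz (memLp_coord _ _) (memLp_coord _ _) fun φ => ?_
  rw [← integral_coord_mul_fourier, ← integral_coord_mul_fourier]
  refine integral_congr_ae ?_
  filter_upwards [(rowCLM l).coeFn_compLp τ] with x hx
  rw [row, hx]
  rfl

theorem fourier_leray_row_ae (τ : MatL2 d) (l k : Fin d) :
    (fun ξ => (𝓕 (leray (row l τ))) ξ k) =ᵐ[volume] fun ξ =>
      (𝓕 τ) ξ (l, k) - dir ξ k * ∑ m, (dir ξ m : ℂ) * (𝓕 τ) ξ (l, m) := by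
  have h1 : 𝓕 (leray (row l τ)) = MemLp.toLp _ (memLp_leraySymbol (𝓕 (row l τ))) :=
    FourierTransform.fourier_fourierInv_eq _
  have h2 : ∀ᵐ ξ, ∀ m, (𝓕 (row l τ)) ξ m = (𝓕 τ) ξ (l, m) :=
    ae_all_iff.2 fun m => fourier_row_ae τ l m
  rw [h1]
  filter_upwards [(memLp_leraySymbol (𝓕 (row l τ))).coeFn_toLp, h2] with ξ h3 h4
  rw [h3, leraySymbol_apply]
  simp only [h4]

end Fourier

section Solution

variable {ω : ℝ} {u₀ : VecL2 d} {τ₀ : MatL2 d} {u : ℝ → VecL2 d} {τ : ℝ → MatL2 d}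

/-- The Fourier transform of a solution satisfies the transformed velocity equation when tested
against Schwartz functions. -/
theorem IsSolution.hasDerivAt_fourier_velocity (h : IsSolution ω u₀ τ₀ u τ)
    (ψ : 𝓢(EuclideanSpace ℝ (Fin d), ℂ)) (k : Fin d) {t : ℝ} (ht : 0 < t) :
    HasDerivAt (fun s => ∫ ξ, (𝓕 (u s)) ξ k * ψ ξ)
      (∫ ξ, velRate ω (wave ξ) (dir ξ) (fun k => (𝓕 (u t)) ξ k)
        (fun j k => (𝓕 (τ t)) ξ (j, k)) k * ψ ξ) t := by
  have h1 := h.velocity_eq (𝓕 ψ) k t ht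
  obtain ⟨χ, hχ, hχ'⟩ := laplacian_fourier ψ
  choose χ₁ h₁ h₁' using fun l => pd_fourier l ψ
  rw [hχ] at h1
  simp only [h₁, integral_coord_mul_fourier] at h1
  refine h1.congr_deriv ?_
  rw [← integral_const_mul, ← integral_finsetSum _ fun l _ => integrable_coord_mul _ _ _,
    ← integral_sub ((integrable_coord_mul _ _ _).const_mul _)
      (integrable_finsetSum _ fun l _ => integrable_coord_mul _ _ _)]
  have h2 : ∀ᵐ ξ, ∀ l, (𝓕 (leray (row l (τ t)))) ξ k =
      (𝓕 (τ t)) ξ (l, k) - dir ξ k * ∑ m, (dir ξ m : ℂ) * (𝓕 (τ t)) ξ (l, m) :=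
    ae_all_iff.2 fun l => fourier_leray_row_ae (τ t) l k
  refine integral_congr_ae ?_
  filter_upwards [h2] with ξ h3
  simp only [h3, hχ', h₁', velRate, transverse]
  rw [add_mul, sub_eq_add_neg, ← Finset.sum_neg_distrib, Finset.mul_sum, Finset.sum_mul]
  congr 1
  · push_cast; ring
  · refine Finset.sum_congr rfl fun l _ => ?_
    have h4 : (wave ξ : ℂ) * dir ξ l = 2 * Real.pi * ξ l := by
      exact_mod_cast congrArg (fun r : ℝ => (r : ℂ)) (wave_mul_dir ξ l)
    linear_combination (-Complex.I * ((𝓕 (τ t)) ξ (l, k) -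
      dir ξ k * ∑ m, (dir ξ m : ℂ) * (𝓕 (τ t)) ξ (l, m)) * ψ ξ) * h4

theorem IsSolution.hasDerivAt_fourier_stress (h : IsSolution ω u₀ τ₀ u τ)
    (ψ : 𝓢(EuclideanSpace ℝ (Fin d), ℂ)) (j k : Fin d) {t : ℝ} (ht : 0 < t) :
    HasDerivAt (fun s => ∫ ξ, (𝓕 (τ s)) ξ (j, k) * ψ ξ)
      (∫ ξ, stressRate ω (wave ξ) (dir ξ) (fun k => (𝓕 (u t)) ξ k)
        (fun j k => (𝓕 (τ t)) ξ (j, k)) j k * ψ ξ) t := by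
  have h1 := h.stress_eq (𝓕 ψ) j k t ht
  choose χ₁ h₁ h₁' using fun l => pd_fourier l ψ
  simp only [h₁, integral_coord_mul_fourier] at h1
  refine h1.congr_deriv ?_
  have h2 : Integrable fun ξ => (ω : ℂ) *
      ((𝓕 (u t)) ξ k * χ₁ j ξ + (𝓕 (u t)) ξ j * χ₁ k ξ) :=
    ((integrable_coord_mul _ _ _).add (integrable_coord_mul _ _ _)).const_mul _
  have h3 : Integrable fun ξ => -((𝓕 (τ t)) ξ (j, k) * ψ ξ) := (integrable_coord_mul _ _ _).neg
  rw [← integral_add (integrable_coord_mul _ _ _) (integrable_coord_mul _ _ _),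
    ← integral_const_mul, ← integral_neg, ← integral_sub h3 h2]
  refine integral_congr_ae (Eventually.of_forall fun ξ => ?_)
  simp only [h₁', stressRate]
  have h4 : ∀ l, (wave ξ : ℂ) * dir ξ l = 2 * Real.pi * ξ l := fun l => by
    exact_mod_cast congrArg (fun r : ℝ => (r : ℂ)) (wave_mul_dir ξ l)
  push_cast
  linear_combination (-Complex.I * ω * (𝓕 (u t)) ξ k * ψ ξ) * h4 j
    + (-Complex.I * ω * (𝓕 (u t)) ξ j * ψ ξ) * h4 k

theorem weight_mul_wave_le (ξ : EuclideanSpace ℝ (Fin d)) :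
    (1 + ‖ξ‖ ^ 2)⁻¹ * wave ξ ≤ 2 * Real.pi := by
  rw [inv_mul_le_iff₀ (by positivity), wave]
  nlinarith [Real.pi_pos, sq_nonneg (‖ξ‖ - 1), mul_nonneg Real.pi_pos.le (sq_nonneg (‖ξ‖ - 1)),
    mul_nonneg Real.pi_pos.le (sq_nonneg ‖ξ‖)]

theorem weight_mul_wave_sq_le (ξ : EuclideanSpace ℝ (Fin d)) :
    (1 + ‖ξ‖ ^ 2)⁻¹ * wave ξ ^ 2 ≤ (2 * Real.pi) ^ 2 := by
  rw [inv_mul_le_iff₀ (by positivity), wave, mul_pow]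
  nlinarith [sq_nonneg (2 * Real.pi)]

theorem wave_nonneg (ξ : EuclideanSpace ℝ (Fin d)) : 0 ≤ wave ξ := by
  unfold wave; positivity

theorem continuous_wave : Continuous (wave (d := d)) := by
  unfold wave; fun_prop

theorem IsSolution.hasL2Deriv_velocity (h : IsSolution ω u₀ τ₀ u τ) (k : Fin d)
    {S : Set (EuclideanSpace ℝ (Fin d))} (hS : MeasurableSet S) {R : ℝ} (hR : ∀ ξ ∈ S, ‖ξ‖ ≤ R) :
    HasL2Deriv (volume.restrict S) (fun t ξ => (𝓕 (u t)) ξ k)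
      (fun t ξ => velRate ω (wave ξ) (dir ξ) (fun k => (𝓕 (u t)) ξ k)
        (fun j k => (𝓕 (τ t)) ξ (j, k)) k) := by
  have hw := continuous_wave (d := d)
  have hη := continuous_weight (E := EuclideanSpace ℝ (Fin d))
  refine hasL2Deriv_of_forall_schwartz (isL2Path_coord h.continuousOn_velocity k) ?_
    (fun ψ t ht => h.hasDerivAt_fourier_velocity ψ k ht) hS hR
  -- after division by `1 + |ξ|²` the symbols of order at most two are bounded
  have h1 := (isL2Path_coord h.continuousOn_velocity k).const_mul
    (c := fun ξ => -((((1 + ‖ξ‖ ^ 2)⁻¹ : ℝ) : ℂ) * (((1 - ω) * wave ξ ^ 2 : ℝ) : ℂ)))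
    (C := |1 - ω| * (2 * Real.pi) ^ 2) (by
      have : Continuous fun ξ : EuclideanSpace ℝ (Fin d) => (((1 - ω) * wave ξ ^ 2 : ℝ) : ℂ) := by
        fun_prop
      exact (hη.mul this).neg.aestronglyMeasurable)
    (Eventually.of_forall fun ξ => by
      rw [norm_neg, ← Complex.ofReal_mul, Complex.norm_real, Real.norm_eq_abs, mul_left_comm,
        abs_mul]
      refine mul_le_mul_of_nonneg_left ?_ (abs_nonneg _)
      rw [abs_of_nonneg (by positivity)]
      exact weight_mul_wave_sq_le ξ)
  have h2 := (IsL2Path.transverse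
    (fun j k => isL2Path_coord h.continuousOn_stress (j, k)) k).const_mul
    (c := fun ξ => (((1 + ‖ξ‖ ^ 2)⁻¹ : ℝ) : ℂ) * (Complex.I * (wave ξ : ℂ)))
    (C := 2 * Real.pi) (by
      have : Continuous fun ξ : EuclideanSpace ℝ (Fin d) => Complex.I * (wave ξ : ℂ) := by
        fun_prop
      exact (hη.mul this).aestronglyMeasurable)
    (Eventually.of_forall fun ξ => by
      rw [norm_mul, norm_mul, Complex.norm_I, one_mul, Complex.norm_real, Complex.norm_real,
        Real.norm_of_nonneg (wave_nonneg ξ), Real.norm_of_nonneg (by positivity)]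
      exact weight_mul_wave_le ξ)
  convert h1.add h2 using 3 with t ξ
  rw [velRate]
  ring

theorem IsSolution.hasL2Deriv_stress (h : IsSolution ω u₀ τ₀ u τ) (j k : Fin d)
    {S : Set (EuclideanSpace ℝ (Fin d))} (hS : MeasurableSet S) {R : ℝ} (hR : ∀ ξ ∈ S, ‖ξ‖ ≤ R) :
    HasL2Deriv (volume.restrict S) (fun t ξ => (𝓕 (τ t)) ξ (j, k))
      (fun t ξ => stressRate ω (wave ξ) (dir ξ) (fun k => (𝓕 (u t)) ξ k)
        (fun j k => (𝓕 (τ t)) ξ (j, k)) j k) := by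
  have hw := continuous_wave (d := d)
  have hη := continuous_weight (E := EuclideanSpace ℝ (Fin d))
  refine hasL2Deriv_of_forall_schwartz (isL2Path_coord h.continuousOn_stress (j, k)) ?_
    (fun ψ t ht => h.hasDerivAt_fourier_stress ψ j k ht) hS hR
  have h1 := (isL2Path_coord h.continuousOn_stress (j, k)).const_mul
    (c := fun ξ => -(((1 + ‖ξ‖ ^ 2)⁻¹ : ℝ) : ℂ)) (C := 1) hη.neg.aestronglyMeasurable
    (Eventually.of_forall fun ξ => by
      rw [norm_neg, Complex.norm_real, Real.norm_of_nonneg (by positivity)]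
      exact inv_le_one_of_one_le₀ (by nlinarith [sq_nonneg ‖ξ‖]))
  have hc : ∀ l i : Fin d, IsL2Path volume fun t ξ =>
      ((((1 + ‖ξ‖ ^ 2)⁻¹ : ℝ) : ℂ) * (Complex.I * ((ω * wave ξ : ℝ) : ℂ)) * (dir ξ l : ℂ)) *
        (𝓕 (u t)) ξ i := by
    intro l i
    refine (isL2Path_coord h.continuousOn_velocity i).const_mul (C := |ω| * (2 * Real.pi)) ?_
      (Eventually.of_forall fun ξ => ?_)
    · have : Continuous fun ξ : EuclideanSpace ℝ (Fin d) =>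
          Complex.I * ((ω * wave ξ : ℝ) : ℂ) := by fun_prop
      exact ((hη.mul this).measurable.mul (measurable_dir l)).aestronglyMeasurable
    · rw [norm_mul, norm_mul, norm_mul, Complex.norm_I, one_mul, Complex.norm_real,
        Complex.norm_real, Real.norm_of_nonneg (show 0 ≤ (1 + ‖ξ‖ ^ 2)⁻¹ by positivity), norm_mul,
        Real.norm_of_nonneg (wave_nonneg ξ), Real.norm_eq_abs]
      calc (1 + ‖ξ‖ ^ 2)⁻¹ * (|ω| * wave ξ) * ‖(dir ξ l : ℂ)‖
          ≤ (1 + ‖ξ‖ ^ 2)⁻¹ * (|ω| * wave ξ) * 1 := by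
            have := wave_nonneg ξ
            gcongr
            exact norm_dir_le ξ l
        _ = |ω| * ((1 + ‖ξ‖ ^ 2)⁻¹ * wave ξ) := by ring
        _ ≤ |ω| * (2 * Real.pi) := 
            mul_le_mul_of_nonneg_left (weight_mul_wave_le ξ) (abs_nonneg ω)
  convert h1.add ((hc j k).add (hc k j)) using 3 with t ξ
  rw [stressRate]
  ring

end Solution

/-! ### Energy inequalities at a fixed frequency -/

section Pointwise

variable {d : ℕ} {ω s : ℝ} {θ : Fin d → ℝ}

theorem two_re_conj_mul_le (z w : ℂ) : 2 * (conj z * w).re ≤ ‖z‖ ^ 2 + ‖w‖ ^ 2 := by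
  have h := Complex.re_le_norm (conj z * w)
  rw [norm_mul, Complex.norm_conj] at h
  nlinarith [sq_nonneg (‖z‖ - ‖w‖)]

theorem re_conj_mul_self (z : ℂ) : (conj z * z).re = ‖z‖ ^ 2 := by
  rw [Complex.conj_mul']
  norm_cast

/-- The component `θ · z` of `z` along `θ`. -/
def longitudinal (θ : Fin d → ℝ) (z : Fin d → ℂ) : ℂ := ∑ k, (θ k : ℂ) * z k

/-- The velocity corrected by the transverse stress. At low frequencies it decouples from the
stress to leading order, and decays like the solution of a heat equation. -/
def corrected (s : ℝ) (θ : Fin d → ℝ) (u : Fin d → ℂ) (A : Fin d → Fin d → ℂ) (k : Fin d) : ℂ :=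
  u k + Complex.I * s * transverse θ A k

theorem norm_longitudinal_sq_le (hθ : ∑ k, θ k ^ 2 = 1) (z : Fin d → ℂ) :
    ‖longitudinal θ z‖ ^ 2 ≤ ∑ k, ‖z k‖ ^ 2 := by
  have h1 : ‖longitudinal θ z‖ ≤ ∑ k, |θ k| * ‖z k‖ :=
    (norm_sum_le _ _).trans_eq (by simp)
  have h2 := Finset.sum_mul_sq_le_sq_mul_sq Finset.univ (fun k => |θ k|) (fun k => ‖z k‖)
  simp only [sq_abs, hθ, one_mul] at h2
  exact (pow_le_pow_left₀ (norm_nonneg _) h1 2).trans h2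

theorem transverse_eq (θ : Fin d → ℝ) (A : Fin d → Fin d → ℂ) (k : Fin d) :
    transverse θ A k = longitudinal θ (fun l => A l k) -
      θ k * longitudinal θ (fun m => longitudinal θ fun l => A l m) := by
  simp only [transverse, longitudinal, mul_sub, Finset.sum_sub_distrib, Finset.mul_sum]
  congr 1
  rw [Finset.sum_comm]
  refine Finset.sum_congr rfl fun m _ => Finset.sum_congr rfl fun l _ => ?_
  ring

theorem sum_ofReal_sq (hθ : ∑ k, θ k ^ 2 = 1) : ∑ k, (θ k : ℂ) * θ k = 1 := by
  rw [← Complex.ofReal_one, ← hθ]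
  push_cast
  exact Finset.sum_congr rfl fun k _ => (sq _).symm

theorem longitudinal_transverse (hθ : ∑ k, θ k ^ 2 = 1) (A : Fin d → Fin d → ℂ) :
    longitudinal θ (transverse θ A) = 0 := by
  rw [longitudinal]
  simp only [transverse_eq, mul_sub, Finset.sum_sub_distrib, ← mul_assoc]
  rw [← Finset.sum_mul, sum_ofReal_sq hθ, one_mul]
  exact sub_self _

theorem sum_norm_transverse_sq_le (hθ : ∑ k, θ k ^ 2 = 1) (A : Fin d → Fin d → ℂ) :
    ∑ k, ‖transverse θ A k‖ ^ 2 ≤ ∑ j, ∑ k, ‖A j k‖ ^ 2 := by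
  set w : Fin d → ℂ := fun k => longitudinal θ fun l => A l k with hw
  set q := longitudinal θ w with hq
  have h1 : ∀ k, ‖transverse θ A k‖ ^ 2 =
      ‖w k‖ ^ 2 - 2 * (conj (θ k * w k) * q).re + θ k ^ 2 * ‖q‖ ^ 2 := by
    intro k
    rw [transverse_eq, ← re_conj_mul_self, ← re_conj_mul_self, ← re_conj_mul_self]
    simp only [Complex.mul_re, Complex.mul_im, Complex.conj_re, Complex.conj_im, Complex.sub_re,
      Complex.sub_im, Complex.ofReal_re, Complex.ofReal_im, ← hw, ← hq]
    ring
  have h2 : ∑ k, (conj (θ k * w k) * q).re = ‖q‖ ^ 2 := by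
    rw [← re_conj_mul_self, ← Complex.re_sum, ← Finset.sum_mul, ← map_sum]
    rfl
  have h3 : ∑ k, ‖transverse θ A k‖ ^ 2 = ∑ k, ‖w k‖ ^ 2 - ‖q‖ ^ 2 := by
    simp only [h1, Finset.sum_add_distrib, Finset.sum_sub_distrib, ← Finset.mul_sum,
      ← Finset.sum_mul, h2, hθ]
    ring
  rw [h3, Finset.sum_comm]
  have h4 : ∑ k, ‖w k‖ ^ 2 ≤ ∑ k, ∑ j, ‖A j k‖ ^ 2 :=
    Finset.sum_le_sum fun k _ => norm_longitudinal_sq_le hθ _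
  nlinarith [sq_nonneg ‖q‖]

theorem longitudinal_velRate (hθ : ∑ k, θ k ^ 2 = 1) (u : Fin d → ℂ) (A : Fin d → Fin d → ℂ) :
    longitudinal θ (velRate ω s θ u A) = -(((1 - ω) * s ^ 2 : ℝ) : ℂ) * longitudinal θ u := by
  have h := longitudinal_transverse hθ A
  simp only [longitudinal] at h ⊢
  calc _ = ∑ k, (-(((1 - ω) * s ^ 2 : ℝ) : ℂ) * (θ k * u k) +
        Complex.I * s * (θ k * transverse θ A k)) :=
        Finset.sum_congr rfl fun k _ => by rw [velRate]; ring
    _ = _ := by rw [Finset.sum_add_distrib, ← Finset.mul_sum, ← Finset.mul_sum, h]; ring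

theorem transverse_stressRate (hθ : ∑ k, θ k ^ 2 = 1) (u : Fin d → ℂ) (A : Fin d → Fin d → ℂ)
    (k : Fin d) : transverse θ (stressRate ω s θ u A) k =
      -transverse θ A k + Complex.I * ((ω * s : ℝ) : ℂ) * (u k - θ k * longitudinal θ u) := by
  have h1 : ∀ m, longitudinal θ (fun l => stressRate ω s θ u A l m) =
      -longitudinal θ (fun l => A l m) +
        Complex.I * ((ω * s : ℝ) : ℂ) * (u m + θ m * longitudinal θ u) := by
    intro m
    simp only [longitudinal]
    calc _ = ∑ l, (-((θ l : ℂ) * A l m) + Complex.I * ((ω * s : ℝ) : ℂ) *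
          ((θ l : ℂ) * θ l * u m + θ m * (θ l * u l))) :=
          Finset.sum_congr rfl fun l _ => by rw [stressRate]; ring
      _ = _ := by
          rw [Finset.sum_add_distrib, Finset.sum_neg_distrib, ← Finset.mul_sum,
            Finset.sum_add_distrib, ← Finset.sum_mul, sum_ofReal_sq hθ, ← Finset.mul_sum, one_mul]
  have h2 : longitudinal θ (fun m => longitudinal θ fun l => stressRate ω s θ u A l m) =
      -longitudinal θ (fun m => longitudinal θ fun l => A l m) +
        Complex.I * ((ω * s : ℝ) : ℂ) * (2 * longitudinal θ u) := by
    simp only [h1]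
    rw [longitudinal]
    calc _ = ∑ m, (-((θ m : ℂ) * longitudinal θ fun l => A l m) +
          Complex.I * ((ω * s : ℝ) : ℂ) *
            (θ m * u m + (θ m : ℂ) * θ m * longitudinal θ u)) :=
          Finset.sum_congr rfl fun l _ => by ring
      _ = _ := by
          rw [Finset.sum_add_distrib, Finset.sum_neg_distrib, ← Finset.mul_sum,
            Finset.sum_add_distrib, ← Finset.sum_mul, sum_ofReal_sq hθ]
          simp only [longitudinal]
          ring
  rw [transverse_eq, transverse_eq, h1, h2]
  ring

/-- The equation `v' = -s² v + i s³ y + ω s² (θ · v) θ` for the corrected velocity: the terms of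
order `s` in which the stress acts on the velocity cancel. -/
theorem corrected_rate (hθ : ∑ k, θ k ^ 2 = 1) (u : Fin d → ℂ) (A : Fin d → Fin d → ℂ)
    (k : Fin d) :
    corrected s θ (velRate ω s θ u A) (stressRate ω s θ u A) k =
      -((s ^ 2 : ℝ) : ℂ) * corrected s θ u A k +
        Complex.I * ((s ^ 3 : ℝ) : ℂ) * transverse θ A k +
        ((ω * s ^ 2 : ℝ) : ℂ) * (θ k * longitudinal θ (corrected s θ u A)) := by
  have h : longitudinal θ (corrected s θ u A) = longitudinal θ u := by
    have h0 := longitudinal_transverse hθ A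
    simp only [longitudinal] at h0 ⊢
    calc _ = ∑ k, ((θ k : ℂ) * u k + Complex.I * s * (θ k * transverse θ A k)) :=
          Finset.sum_congr rfl fun k _ => by rw [corrected]; ring
      _ = _ := by rw [Finset.sum_add_distrib, ← Finset.mul_sum, h0]; ring
  rw [h, corrected, corrected, transverse_stressRate hθ, velRate]
  push_cast
  linear_combination (ω * s ^ 2 * (u k - θ k * longitudinal θ u)) * Complex.I_sq

theorem sum_norm_velocity_sq_le (hθ : ∑ k, θ k ^ 2 = 1) (u : Fin d → ℂ)
    (A : Fin d → Fin d → ℂ) :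
    ∑ k, ‖u k‖ ^ 2 ≤ 2 * ∑ k, ‖corrected s θ u A k‖ ^ 2 + 2 * s ^ 2 * ∑ j, ∑ k, ‖A j k‖ ^ 2 := by
  have h1 : ∀ k, ‖u k‖ ^ 2 ≤
      2 * ‖corrected s θ u A k‖ ^ 2 + 2 * s ^ 2 * ‖transverse θ A k‖ ^ 2 := by
    intro k
    have h2 : u k = corrected s θ u A k - Complex.I * s * transverse θ A k := by
      rw [corrected]; ring
    have h3 := norm_sub_le (corrected s θ u A k) (Complex.I * s * transverse θ A k)
    rw [← h2, norm_mul, norm_mul, Complex.norm_I, one_mul, Complex.norm_real,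
      Real.norm_eq_abs] at h3
    calc ‖u k‖ ^ 2 ≤ (‖corrected s θ u A k‖ + |s| * ‖transverse θ A k‖) ^ 2 := by gcongr
      _ ≤ 2 * ‖corrected s θ u A k‖ ^ 2 + 2 * (|s| * ‖transverse θ A k‖) ^ 2 := by
        nlinarith [sq_nonneg (‖corrected s θ u A k‖ - |s| * ‖transverse θ A k‖)]
      _ = _ := by rw [mul_pow, sq_abs]; ring
  calc _ ≤ ∑ k, (2 * ‖corrected s θ u A k‖ ^ 2 + 2 * s ^ 2 * ‖transverse θ A k‖ ^ 2) :=
        Finset.sum_le_sum fun k _ => h1 k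
    _ = 2 * ∑ k, ‖corrected s θ u A k‖ ^ 2 + 2 * s ^ 2 * ∑ k, ‖transverse θ A k‖ ^ 2 := by
        rw [Finset.sum_add_distrib, Finset.mul_sum, Finset.mul_sum]
    _ ≤ _ := add_le_add_right
        (mul_le_mul_of_nonneg_left (sum_norm_transverse_sq_le hθ A) (by positivity)) _

theorem sum_norm_corrected_sq_le (hθ : ∑ k, θ k ^ 2 = 1) (u : Fin d → ℂ)
    (A : Fin d → Fin d → ℂ) :
    ∑ k, ‖corrected s θ u A k‖ ^ 2 ≤ 2 * ∑ k, ‖u k‖ ^ 2 + 2 * s ^ 2 * ∑ j, ∑ k, ‖A j k‖ ^ 2 := by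
  have h1 : ∀ k, ‖corrected s θ u A k‖ ^ 2 ≤
      2 * ‖u k‖ ^ 2 + 2 * s ^ 2 * ‖transverse θ A k‖ ^ 2 := by
    intro k
    have h3 := norm_add_le (u k) (Complex.I * s * transverse θ A k)
    rw [norm_mul, norm_mul, Complex.norm_I, one_mul, Complex.norm_real, Real.norm_eq_abs] at h3
    calc ‖corrected s θ u A k‖ ^ 2 ≤ (‖u k‖ + |s| * ‖transverse θ A k‖) ^ 2 := by
          gcongr; exact h3
      _ ≤ 2 * ‖u k‖ ^ 2 + 2 * (|s| * ‖transverse θ A k‖) ^ 2 := by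
        nlinarith [sq_nonneg (‖u k‖ - |s| * ‖transverse θ A k‖)]
      _ = _ := by rw [mul_pow, sq_abs]; ring
  calc _ ≤ ∑ k, (2 * ‖u k‖ ^ 2 + 2 * s ^ 2 * ‖transverse θ A k‖ ^ 2) :=
        Finset.sum_le_sum fun k _ => h1 k
    _ = 2 * ∑ k, ‖u k‖ ^ 2 + 2 * s ^ 2 * ∑ k, ‖transverse θ A k‖ ^ 2 := by
        rw [Finset.sum_add_distrib, Finset.mul_sum, Finset.mul_sum]
    _ ≤ _ := add_le_add_right
        (mul_le_mul_of_nonneg_left (sum_norm_transverse_sq_le hθ A) (by positivity)) _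

theorem corrected_energy_rate_le (hω : 0 ≤ ω) (hs : 0 ≤ s) (hθ : ∑ k, θ k ^ 2 = 1)
    (u : Fin d → ℂ) (A : Fin d → Fin d → ℂ) :
    ∑ k, 2 * (conj (corrected s θ u A k) *
        corrected s θ (velRate ω s θ u A) (stressRate ω s θ u A) k).re ≤
      (-2 * (1 - ω) * s ^ 2 + s ^ 3) * ∑ k, ‖corrected s θ u A k‖ ^ 2 +
        s ^ 3 * ∑ j, ∑ k, ‖A j k‖ ^ 2 := by
  set v := corrected s θ u A with hv
  set q := longitudinal θ v with hq
  have h1 : ∀ k, 2 * (conj (v k) * corrected s θ (velRate ω s θ u A) (stressRate ω s θ u A) k).re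
      ≤ (-2 * s ^ 2 + s ^ 3) * ‖v k‖ ^ 2 + s ^ 3 * ‖transverse θ A k‖ ^ 2 +
        2 * (ω * s ^ 2) * (conj (θ k * v k) * q).re := by
    intro k
    have h2 : conj (v k) * corrected s θ (velRate ω s θ u A) (stressRate ω s θ u A) k =
        ((-s ^ 2 : ℝ) : ℂ) * (conj (v k) * v k) +
        ((s ^ 3 : ℝ) : ℂ) * (conj (v k) * (Complex.I * transverse θ A k)) +
        ((ω * s ^ 2 : ℝ) : ℂ) * (conj (θ k * v k) * q) := by
      rw [corrected_rate hθ, map_mul, Complex.conj_ofReal, ← hv, ← hq]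
      push_cast
      ring
    rw [h2, Complex.add_re, Complex.add_re, Complex.re_ofReal_mul, Complex.re_ofReal_mul,
      Complex.re_ofReal_mul, re_conj_mul_self]
    have h3 := two_re_conj_mul_le (v k) (Complex.I * transverse θ A k)
    rw [norm_mul, Complex.norm_I, one_mul] at h3
    nlinarith [mul_le_mul_of_nonneg_left h3 (pow_nonneg hs 3)]
  have h2 : ∑ k, (conj (θ k * v k) * q).re = ‖q‖ ^ 2 := by
    rw [← re_conj_mul_self, ← Complex.re_sum, ← Finset.sum_mul, ← map_sum]
    rfl
  refine (Finset.sum_le_sum fun k _ => h1 k).trans ?_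
  rw [Finset.sum_add_distrib, Finset.sum_add_distrib, ← Finset.mul_sum, ← Finset.mul_sum,
    ← Finset.mul_sum, h2]
  have h3 := mul_le_mul_of_nonneg_left (norm_longitudinal_sq_le hθ v)
    (show 0 ≤ 2 * (ω * s ^ 2) by positivity)
  have h4 := mul_le_mul_of_nonneg_left (sum_norm_transverse_sq_le hθ A) (pow_nonneg hs 3)
  linarith

theorem sum_sum_norm_dir_mul_sq (hθ : ∑ k, θ k ^ 2 = 1) (u : Fin d → ℂ) :
    ∑ j, ∑ k, ‖(θ j : ℂ) * u k‖ ^ 2 = ∑ k, ‖u k‖ ^ 2 := by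
  simp only [norm_mul, mul_pow, Complex.norm_real, Real.norm_eq_abs, sq_abs, ← Finset.mul_sum]
  rw [← Finset.sum_mul, hθ, one_mul]

theorem stress_energy_rate_le (hω : 0 ≤ ω) (hω₁ : ω ≤ 1) (hs : 0 ≤ s)
    (hθ : ∑ k, θ k ^ 2 = 1) (u : Fin d → ℂ) (A : Fin d → Fin d → ℂ) :
    ∑ j, ∑ k, 2 * (conj (A j k) * stressRate ω s θ u A j k).re ≤
      (-2 + 2 * s + 4 * s ^ 3) * ∑ j, ∑ k, ‖A j k‖ ^ 2 +
        4 * s * ∑ k, ‖corrected s θ u A k‖ ^ 2 := by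
  have h1 : ∀ j k, 2 * (conj (A j k) * stressRate ω s θ u A j k).re ≤
      (-2 + 2 * s) * ‖A j k‖ ^ 2 + s * ‖(θ j : ℂ) * u k‖ ^ 2 + s * ‖(θ k : ℂ) * u j‖ ^ 2 := by
    intro j k
    have h2 : conj (A j k) * stressRate ω s θ u A j k = -(conj (A j k) * A j k) +
        ((ω * s : ℝ) : ℂ) * (conj (A j k) * (Complex.I * (θ j * u k))) +
        ((ω * s : ℝ) : ℂ) * (conj (A j k) * (Complex.I * (θ k * u j))) := by
      rw [stressRate]; ring
    have h3 := two_re_conj_mul_le (A j k) (Complex.I * (θ j * u k))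
    have h4 := two_re_conj_mul_le (A j k) (Complex.I * (θ k * u j))
    rw [norm_mul Complex.I, Complex.norm_I, one_mul] at h3 h4
    rw [h2, Complex.add_re, Complex.add_re, Complex.neg_re, Complex.re_ofReal_mul,
      Complex.re_ofReal_mul, re_conj_mul_self]
    have h5 : ω * s ≤ s := by nlinarith
    have h6 : 0 ≤ ω * s := by positivity
    have h7 := mul_le_mul_of_nonneg_left h3 h6
    have h8 := mul_le_mul_of_nonneg_left h4 h6
    have h9 := mul_le_mul_of_nonneg_right h5
      (show 0 ≤ ‖A j k‖ ^ 2 + ‖(θ j : ℂ) * u k‖ ^ 2 by positivity)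
    have h10 := mul_le_mul_of_nonneg_right h5
      (show 0 ≤ ‖A j k‖ ^ 2 + ‖(θ k : ℂ) * u j‖ ^ 2 by positivity)
    linarith
  refine (Finset.sum_le_sum fun j _ => Finset.sum_le_sum fun k _ => h1 j k).trans ?_
  have h2 : ∑ j, ∑ k, ‖(θ k : ℂ) * u j‖ ^ 2 = ∑ k, ‖u k‖ ^ 2 := by
    rw [Finset.sum_comm, sum_sum_norm_dir_mul_sq hθ]
  simp only [Finset.sum_add_distrib, ← Finset.mul_sum]
  rw [h2, sum_sum_norm_dir_mul_sq hθ]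
  have h3 := mul_le_mul_of_nonneg_left (sum_norm_velocity_sq_le (s := s) hθ u A) hs
  linarith

/-- The energy density used at low frequencies. The weight `s²` accounts for
the stress entering the velocity only through its divergence. -/
def lowEnergy (s : ℝ) (θ : Fin d → ℝ) (u : Fin d → ℂ) (A : Fin d → Fin d → ℂ) : ℝ :=
  ∑ k, ‖corrected s θ u A k‖ ^ 2 + s ^ 2 * ∑ j, ∑ k, ‖A j k‖ ^ 2

/-- The time derivative of `lowEnergy` along the system. -/
def lowEnergyRate (ω s : ℝ) (θ : Fin d → ℝ) (u : Fin d → ℂ) (A : Fin d → Fin d → ℂ) : ℝ :=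
  ∑ k, 2 * (conj (corrected s θ u A k) *
      corrected s θ (velRate ω s θ u A) (stressRate ω s θ u A) k).re +
    s ^ 2 * ∑ j, ∑ k, 2 * (conj (A j k) * stressRate ω s θ u A j k).re

theorem lowEnergyRate_le (hω : 0 ≤ ω) (hω₁ : ω ≤ 1) (hs : 0 ≤ s) (hs₁ : s ≤ (1 - ω) / 6)
    (hθ : ∑ k, θ k ^ 2 = 1) (u : Fin d → ℂ) (A : Fin d → Fin d → ℂ) :
    lowEnergyRate ω s θ u A ≤ -((1 - ω) * s ^ 2 * lowEnergy s θ u A) := by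
  have h1 := corrected_energy_rate_le hω hs hθ u A
  have h2 := mul_le_mul_of_nonneg_left (stress_energy_rate_le hω hω₁ hs hθ u A) (sq_nonneg s)
  rw [lowEnergyRate, lowEnergy]
  have hV : 0 ≤ ∑ k, ‖corrected s θ u A k‖ ^ 2 := by positivity
  have hW : 0 ≤ ∑ j, ∑ k, ‖A j k‖ ^ 2 := by positivity
  set V := ∑ k, ‖corrected s θ u A k‖ ^ 2
  set W := ∑ j, ∑ k, ‖A j k‖ ^ 2
  have h3 : s ≤ 1 / 6 := by linarith
  have h4 : s ^ 2 ≤ 1 / 36 := by nlinarith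
  have h5 : 0 ≤ s ^ 2 * V * ((1 - ω) - 5 * s) := by
    have : 0 ≤ (1 - ω) - 5 * s := by linarith
    positivity
  have h6 : 0 ≤ s ^ 2 * W * (2 - 3 * s - 4 * s * s ^ 2 - (1 - ω) * s ^ 2) := by
    have : 0 ≤ 2 - 3 * s - 4 * s * s ^ 2 - (1 - ω) * s ^ 2 := by nlinarith
    positivity
  nlinarith

theorem stress_energy_rate_le_of_low (hω : 0 ≤ ω) (hω₁ : ω ≤ 1) (hs : 0 ≤ s) (hs₁ : s ≤ (1 - ω) / 6)
    (hθ : ∑ k, θ k ^ 2 = 1) (u : Fin d → ℂ) (A : Fin d → Fin d → ℂ) :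
    ∑ j, ∑ k, 2 * (conj (A j k) * stressRate ω s θ u A j k).re ≤
      -∑ j, ∑ k, ‖A j k‖ ^ 2 + lowEnergy s θ u A := by
  have h1 := stress_energy_rate_le hω hω₁ hs hθ u A
  rw [lowEnergy]
  have hV : 0 ≤ ∑ k, ‖corrected s θ u A k‖ ^ 2 := by positivity
  have hW : 0 ≤ ∑ j, ∑ k, ‖A j k‖ ^ 2 := by positivity
  set V := ∑ k, ‖corrected s θ u A k‖ ^ 2
  set W := ∑ j, ∑ k, ‖A j k‖ ^ 2
  have h3 : s ≤ 1 / 6 := by linarith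
  have h4 : s ^ 2 ≤ 1 / 36 := by nlinarith
  have h5 : 0 ≤ V * (1 - 4 * s) := by
    have : 0 ≤ 1 - 4 * s := by linarith
    positivity
  have h6 : 0 ≤ W * (1 - 2 * s - 4 * s * s ^ 2 + s ^ 2) := by
    have : 0 ≤ 1 - 2 * s - 4 * s * s ^ 2 + s ^ 2 := by nlinarith
    positivity
  nlinarith

/-- The energy density used at high frequencies. The first two terms are the energy of the
system; the last two control the longitudinal velocity and the antisymmetric stress, the only
quantities in the interaction terms that do not cancel in the energy balance. -/
def highEnergy (ω : ℝ) (θ : Fin d → ℝ) (u : Fin d → ℂ) (A : Fin d → Fin d → ℂ) : ℝ :=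
  ω * ∑ k, ‖u k‖ ^ 2 + 1 / 2 * ∑ j, ∑ k, ‖A j k‖ ^ 2 +
    (2 / (1 - ω) * ‖longitudinal θ u‖ ^ 2 + 1 / (1 - ω) * ∑ j, ∑ k, ‖A j k - A k j‖ ^ 2)

/-- The time derivative of `highEnergy` along the system. -/
def highEnergyRate (ω s : ℝ) (θ : Fin d → ℝ) (u : Fin d → ℂ) (A : Fin d → Fin d → ℂ) : ℝ :=
  ω * ∑ k, 2 * (conj (u k) * velRate ω s θ u A k).re +
      1 / 2 * ∑ j, ∑ k, 2 * (conj (A j k) * stressRate ω s θ u A j k).re +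
      (2 / (1 - ω) * (2 * (conj (longitudinal θ u) * longitudinal θ (velRate ω s θ u A)).re) +
      1 / (1 - ω) * ∑ j, ∑ k, 2 * (conj (A j k - A k j) *
        (stressRate ω s θ u A j k - stressRate ω s θ u A k j)).re)

/-- The interaction terms of the energy balance involve only the antisymmetric part of the stress
and the longitudinal part of the velocity. -/
theorem cross_terms_eq (u : Fin d → ℂ) (A : Fin d → Fin d → ℂ) :
    2 * ∑ k, (conj (u k) * (Complex.I * transverse θ A k)).re +
      ∑ j, ∑ k, (conj (A j k) * (Complex.I * (θ j * u k + θ k * u j))).re =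
    ∑ j, ∑ k, (conj (θ j * u k) * (Complex.I * (A j k - A k j))).re -
      2 * (conj (longitudinal θ u) *
        (Complex.I * longitudinal θ fun m => longitudinal θ fun l => A l m)).re := by
  set κ := longitudinal θ fun m => longitudinal θ fun l => A l m with hκ
  have h1 : ∑ k, (conj (u k) * (Complex.I * transverse θ A k)).re =
      ∑ j, ∑ k, (conj (θ j * u k) * (Complex.I * A j k)).re -
        (conj (longitudinal θ u) * (Complex.I * κ)).re := by
    have h2 : ∀ k, conj (u k) * (Complex.I * transverse θ A k) =
        ∑ j, conj (θ j * u k) * (Complex.I * A j k) - conj (θ k * u k) * (Complex.I * κ) := by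
      intro k
      rw [transverse_eq, ← hκ, longitudinal, mul_sub, mul_sub, Finset.mul_sum, Finset.mul_sum]
      simp only [map_mul, Complex.conj_ofReal]
      congr 1
      · exact Finset.sum_congr rfl fun j _ => by ring
      · ring
    have h3 : conj (longitudinal θ u) * (Complex.I * κ) =
        ∑ k, conj (θ k * u k) * (Complex.I * κ) := by
      rw [longitudinal, map_sum, Finset.sum_mul]
    rw [h3]
    simp only [h2, Complex.sub_re, Complex.re_sum, Finset.sum_sub_distrib]
    rw [Finset.sum_comm]
  have h4 : ∀ j k, (conj (A j k) * (Complex.I * (θ j * u k + θ k * u j))).re =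
      -(conj (θ j * u k) * (Complex.I * A j k)).re -
        (conj (θ k * u j) * (Complex.I * A j k)).re := by
    intro j k
    simp [Complex.mul_re, Complex.mul_im]
    ring
  have h5 : ∑ j, ∑ k, (conj (θ k * u j) * (Complex.I * A j k)).re =
      ∑ j, ∑ k, (conj (θ j * u k) * (Complex.I * A k j)).re := Finset.sum_comm
  rw [h1]
  simp only [h4, mul_sub, Complex.sub_re, Finset.sum_sub_distrib, Finset.sum_neg_distrib, h5]
  ring

theorem norm_longitudinal_longitudinal_sq_le (hθ : ∑ k, θ k ^ 2 = 1) (A : Fin d → Fin d → ℂ) :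
    ‖longitudinal θ fun m => longitudinal θ fun l => A l m‖ ^ 2 ≤ ∑ j, ∑ k, ‖A j k‖ ^ 2 := by
  refine (norm_longitudinal_sq_le hθ _).trans ?_
  rw [Finset.sum_comm]
  exact Finset.sum_le_sum fun k _ => norm_longitudinal_sq_le hθ _

theorem highEnergyRate_le (hω : 0 < ω) (hω₁ : ω < 1) (hs : 0 ≤ s)
    (hθ : ∑ k, θ k ^ 2 = 1) (u : Fin d → ℂ) (A : Fin d → Fin d → ℂ) :
    highEnergyRate ω s θ u A ≤
    -((1 - ω) * s ^ 2 * (ω * ∑ k, ‖u k‖ ^ 2) + 1 / 2 * ∑ j, ∑ k, ‖A j k‖ ^ 2 +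
      ((1 - ω) * s ^ 2 * (2 / (1 - ω) * ‖longitudinal θ u‖ ^ 2) +
        1 / (1 - ω) * ∑ j, ∑ k, ‖A j k - A k j‖ ^ 2)) := by
  set b := 1 - ω with hb
  have hb0 : 0 < b := by linarith
  set κ := longitudinal θ fun m => longitudinal θ fun l => A l m with hκ
  have hu : ∑ k, 2 * (conj (u k) * velRate ω s θ u A k).re =
      -2 * (b * s ^ 2) * ∑ k, ‖u k‖ ^ 2 +
        s * (2 * ∑ k, (conj (u k) * (Complex.I * transverse θ A k)).re) := by
    rw [Finset.mul_sum, Finset.mul_sum, Finset.mul_sum, ← Finset.sum_add_distrib]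
    refine Finset.sum_congr rfl fun k _ => ?_
    have h2 : conj (u k) * velRate ω s θ u A k = ((-(b * s ^ 2) : ℝ) : ℂ) * (conj (u k) * u k) +
        (s : ℂ) * (conj (u k) * (Complex.I * transverse θ A k)) := by
      rw [velRate, ← hb]; push_cast; ring
    rw [h2, Complex.add_re, Complex.re_ofReal_mul, Complex.re_ofReal_mul, re_conj_mul_self]
    ring
  have hA : ∑ j, ∑ k, 2 * (conj (A j k) * stressRate ω s θ u A j k).re =
      -2 * ∑ j, ∑ k, ‖A j k‖ ^ 2 + 2 * (ω * s) *
        ∑ j, ∑ k, (conj (A j k) * (Complex.I * (θ j * u k + θ k * u j))).re := by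
    simp only [Finset.mul_sum, ← Finset.sum_add_distrib]
    refine Finset.sum_congr rfl fun j _ => Finset.sum_congr rfl fun k _ => ?_
    have h2 : conj (A j k) * stressRate ω s θ u A j k = -(conj (A j k) * A j k) +
        ((ω * s : ℝ) : ℂ) * (conj (A j k) * (Complex.I * (θ j * u k + θ k * u j))) := by
      rw [stressRate]; ring
    rw [h2, Complex.add_re, Complex.neg_re, Complex.re_ofReal_mul, re_conj_mul_self]
    ring
  have hq : (conj (longitudinal θ u) * longitudinal θ (velRate ω s θ u A)).re =
      -(b * s ^ 2) * ‖longitudinal θ u‖ ^ 2 := by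
    rw [longitudinal_velRate hθ, ← hb, mul_left_comm, ← Complex.ofReal_neg,
      Complex.re_ofReal_mul, re_conj_mul_self]
  have ha : ∑ j, ∑ k, 2 * (conj (A j k - A k j) *
      (stressRate ω s θ u A j k - stressRate ω s θ u A k j)).re =
      -2 * ∑ j, ∑ k, ‖A j k - A k j‖ ^ 2 := by
    simp only [Finset.mul_sum]
    refine Finset.sum_congr rfl fun j _ => Finset.sum_congr rfl fun k _ => ?_
    have h2 : stressRate ω s θ u A j k - stressRate ω s θ u A k j = -(A j k - A k j) := by
      rw [stressRate, stressRate]; ring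
    rw [h2, mul_neg, Complex.neg_re, re_conj_mul_self]
    ring
  have hcross := cross_terms_eq (θ := θ) u A
  rw [← hκ] at hcross
  -- the remaining interaction terms, by Young's inequality with weights that keep half of
  -- the dissipation
  have hY₁ : ω * s * ∑ j, ∑ k, (conj (θ j * u k) * (Complex.I * (A j k - A k j))).re ≤
      ω * b * s ^ 2 * ∑ k, ‖u k‖ ^ 2 + 1 / b * ∑ j, ∑ k, ‖A j k - A k j‖ ^ 2 := by
    rw [← sum_sum_norm_dir_mul_sq hθ u]
    simp only [Finset.mul_sum, ← Finset.sum_add_distrib]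
    refine Finset.sum_le_sum fun j _ => Finset.sum_le_sum fun k _ => ?_
    have h1 := Complex.re_le_norm (conj (θ j * u k) * (Complex.I * (A j k - A k j)))
    rw [norm_mul, norm_mul Complex.I, Complex.norm_I, one_mul, Complex.norm_conj] at h1
    set x := ‖(θ j : ℂ) * u k‖
    set y := ‖A j k - A k j‖
    have hx : 0 ≤ x := norm_nonneg _
    have hy : 0 ≤ y := norm_nonneg _
    have h2 := mul_le_mul_of_nonneg_left h1 (show 0 ≤ ω * s by positivity)
    refine h2.trans ?_
    have h3 : ω * s * (x * y) * b ≤ (ω * b * s ^ 2 * x ^ 2 + 1 / b * y ^ 2) * b := by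
      have h4 : (ω * b * s ^ 2 * x ^ 2 + 1 / b * y ^ 2) * b = ω * (b * s * x) ^ 2 + y ^ 2 := by
        field_simp
      rw [h4]
      have h5 : 0 ≤ (1 - ω) * y ^ 2 := by positivity
      nlinarith [mul_nonneg hω.le (sq_nonneg (b * s * x - y)), mul_nonneg hω.le (sq_nonneg y),
        mul_nonneg hω.le (sq_nonneg (b * s * x))]
    exact le_of_mul_le_mul_right h3 hb0
  have hY₂ : -(2 * (ω * s) * (conj (longitudinal θ u) * (Complex.I * κ)).re) ≤
      1 / 2 * ∑ j, ∑ k, ‖A j k‖ ^ 2 + 2 * s ^ 2 * ‖longitudinal θ u‖ ^ 2 := by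
    have h1 := (abs_le.1 (Complex.abs_re_le_norm (conj (longitudinal θ u) * (Complex.I * κ)))).1
    rw [norm_mul, norm_mul Complex.I, Complex.norm_I, one_mul, Complex.norm_conj] at h1
    have h2 := norm_longitudinal_longitudinal_sq_le hθ A
    rw [← hκ] at h2
    set x := ‖longitudinal θ u‖
    set y := ‖κ‖
    have hx : 0 ≤ x := norm_nonneg _
    have hy : 0 ≤ y := norm_nonneg _
    have h3 := mul_le_mul_of_nonneg_left h1 (show 0 ≤ 2 * (ω * s) by positivity)
    have h4 : ω * (s * (x * y)) ≤ s * (x * y) := by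
      have : 0 ≤ s * (x * y) := by positivity
      nlinarith
    nlinarith [sq_nonneg (2 * (s * x) - y)]
  rw [highEnergyRate, ← hb, hu, hA, hq, ha]
  have e1 : 2 / b * (2 * (-(b * s ^ 2) * ‖longitudinal θ u‖ ^ 2)) =
      -4 * s ^ 2 * ‖longitudinal θ u‖ ^ 2 := by field_simp; ring
  have e2 : b * s ^ 2 * (2 / b * ‖longitudinal θ u‖ ^ 2) =
      2 * s ^ 2 * ‖longitudinal θ u‖ ^ 2 := by field_simp
  rw [e1, e2]
  have h9 := congrArg (fun r => ω * s * r) hcross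
  beta_reduce at h9
  linarith

theorem highEnergyRate_le_neg_mul {σ : ℝ} (hω : 0 < ω) (hω₁ : ω < 1) (hσ : 0 ≤ σ)
    (hσs : σ ≤ s) (hσ₁ : σ ≤ 1) (hθ : ∑ k, θ k ^ 2 = 1) (u : Fin d → ℂ)
    (A : Fin d → Fin d → ℂ) :
    highEnergyRate ω s θ u A ≤
    -((1 - ω) * σ ^ 2 * highEnergy ω θ u A) := by
  refine (highEnergyRate_le hω hω₁ (hσ.trans hσs) hθ u A).trans ?_
  have hb0 : 0 < 1 - ω := by linarith
  have h1 : σ ^ 2 ≤ s ^ 2 := by gcongr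
  have h2 : (1 - ω) * σ ^ 2 ≤ (1 - ω) * s ^ 2 := by gcongr
  have h3 : (1 - ω) * σ ^ 2 ≤ 1 := by nlinarith
  rw [highEnergy, neg_le_neg_iff]
  have hU : 0 ≤ ω * ∑ k, ‖u k‖ ^ 2 := by positivity
  have hW : 0 ≤ 1 / 2 * ∑ j, ∑ k, ‖A j k‖ ^ 2 := by positivity
  have hQ : 0 ≤ 2 / (1 - ω) * ‖longitudinal θ u‖ ^ 2 := by positivity
  have hN : 0 ≤ 1 / (1 - ω) * ∑ j, ∑ k, ‖A j k - A k j‖ ^ 2 := by positivity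
  have k1 := mul_le_mul_of_nonneg_right h2 hU
  have k2 := mul_le_mul_of_nonneg_right h3 hW
  have k3 := mul_le_mul_of_nonneg_right h2 hQ
  have k4 := mul_le_mul_of_nonneg_right h3 hN
  linarith

theorem energy_le_highEnergy (hω₁ : ω < 1) (u : Fin d → ℂ) (A : Fin d → Fin d → ℂ) :
    ω * ∑ k, ‖u k‖ ^ 2 + 1 / 2 * ∑ j, ∑ k, ‖A j k‖ ^ 2 ≤ highEnergy ω θ u A := by
  have hb0 : 0 < 1 - ω := by linarith
  rw [highEnergy]
  exact le_add_of_nonneg_right (by positivity)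

theorem highEnergy_le (hω : 0 < ω) (hω₁ : ω < 1) (hθ : ∑ k, θ k ^ 2 = 1) (u : Fin d → ℂ)
    (A : Fin d → Fin d → ℂ) :
    highEnergy ω θ u A ≤ 5 / (1 - ω) * (∑ k, ‖u k‖ ^ 2 + ∑ j, ∑ k, ‖A j k‖ ^ 2) := by
  have hb0 : 0 < 1 - ω := by linarith
  have h1 : ∑ j, ∑ k, ‖A j k - A k j‖ ^ 2 ≤ 4 * ∑ j, ∑ k, ‖A j k‖ ^ 2 := by
    have h2 : ∀ j k, ‖A j k - A k j‖ ^ 2 ≤ 2 * ‖A j k‖ ^ 2 + 2 * ‖A k j‖ ^ 2 := by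
      intro j k
      have := norm_sub_le (A j k) (A k j)
      calc _ ≤ (‖A j k‖ + ‖A k j‖) ^ 2 := by gcongr
        _ ≤ _ := by nlinarith [sq_nonneg (‖A j k‖ - ‖A k j‖)]
    refine (Finset.sum_le_sum fun j _ => Finset.sum_le_sum fun k _ => h2 j k).trans_eq ?_
    have h3 : ∑ j, ∑ k, ‖A k j‖ ^ 2 = ∑ j, ∑ k, ‖A j k‖ ^ 2 := Finset.sum_comm
    simp only [Finset.sum_add_distrib, ← Finset.mul_sum]
    rw [h3]; ring
  have h2 := norm_longitudinal_sq_le hθ u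
  rw [highEnergy]
  have hU : 0 ≤ ∑ k, ‖u k‖ ^ 2 := by positivity
  have hW : 0 ≤ ∑ j, ∑ k, ‖A j k‖ ^ 2 := by positivity
  set U := ∑ k, ‖u k‖ ^ 2
  set W := ∑ j, ∑ k, ‖A j k‖ ^ 2
  have hbi : 1 ≤ 1 / (1 - ω) := by
    rw [le_div_iff₀ hb0]; linarith
  have k1 : 2 / (1 - ω) * ‖longitudinal θ u‖ ^ 2 ≤ 2 / (1 - ω) * U := by gcongr
  have k2 : 1 / (1 - ω) * ∑ j, ∑ k, ‖A j k - A k j‖ ^ 2 ≤ 1 / (1 - ω) * (4 * W) := by gcongr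
  have k3 : ω * U ≤ 1 / (1 - ω) * U := by gcongr; linarith
  have k4 : 1 / 2 * W ≤ 1 / (1 - ω) * W := by gcongr; linarith
  have e1 : 2 / (1 - ω) = 2 * (1 / (1 - ω)) := by ring
  have e2 : 5 / (1 - ω) = 5 * (1 / (1 - ω)) := by ring
  rw [e1] at k1 ⊢
  rw [e2]
  have k5 : 0 ≤ 1 / (1 - ω) * U := by positivity
  linarith

end Pointwise

/-! ### Decay of the energy -/

section Densities

variable {d : ℕ} {ω R : ℝ} {μ : Measure (EuclideanSpace ℝ (Fin d))}
  {U : ℝ → EuclideanSpace ℝ (Fin d) → Fin d → ℂ}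
  {A : ℝ → EuclideanSpace ℝ (Fin d) → Fin d → Fin d → ℂ}

theorem norm_wave_le {ξ : EuclideanSpace ℝ (Fin d)} (h : ‖ξ‖ ≤ R) :
    ‖(wave ξ : ℂ)‖ ≤ 2 * Real.pi * R := by
  rw [Complex.norm_real, Real.norm_of_nonneg (wave_nonneg ξ), wave]
  gcongr

theorem sum_dir_sq {ξ : EuclideanSpace ℝ (Fin d)} (h : ξ ≠ 0) : ∑ k, dir ξ k ^ 2 = 1 := by
  simp only [dir, div_pow, ← Finset.sum_div]
  rw [← EuclideanSpace.real_norm_sq_eq]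
  exact div_self (pow_ne_zero 2 (norm_ne_zero_iff.2 h))

theorem ae_sum_dir_sq (hd : 1 ≤ d) :
    ∀ᵐ ξ : EuclideanSpace ℝ (Fin d), ∑ k, dir ξ k ^ 2 = 1 := by
  have : Nonempty (Fin d) := ⟨⟨0, hd⟩⟩
  have : ∀ᵐ ξ : EuclideanSpace ℝ (Fin d), ξ ≠ 0 := by
    rw [ae_iff]
    simp
  filter_upwards [this] with ξ hξ using sum_dir_sq hξ

theorem hasEnergyDeriv_stress
    (hA : ∀ j k, HasL2Deriv μ (fun t ξ => A t ξ j k)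
      (fun t ξ => stressRate ω (wave ξ) (dir ξ) (U t ξ) (A t ξ) j k)) :
    HasEnergyDeriv μ (fun t ξ => ∑ j, ∑ k, ‖A t ξ j k‖ ^ 2)
      (fun t ξ => ∑ j, ∑ k, 2 * (conj (A t ξ j k) *
        stressRate ω (wave ξ) (dir ξ) (U t ξ) (A t ξ) j k).re) :=
  HasEnergyDeriv.sum _ fun j _ => HasEnergyDeriv.sum _ fun k _ => (hA j k).hasEnergyDeriv

theorem hasEnergyDeriv_lowEnergy (hR : ∀ᵐ ξ ∂μ, ‖ξ‖ ≤ R)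
    (hU : ∀ k, HasL2Deriv μ (fun t ξ => U t ξ k)
      (fun t ξ => velRate ω (wave ξ) (dir ξ) (U t ξ) (A t ξ) k))
    (hA : ∀ j k, HasL2Deriv μ (fun t ξ => A t ξ j k)
      (fun t ξ => stressRate ω (wave ξ) (dir ξ) (U t ξ) (A t ξ) j k)) :
    HasEnergyDeriv μ (fun t ξ => lowEnergy (wave ξ) (dir ξ) (U t ξ) (A t ξ))
      (fun t ξ => lowEnergyRate ω (wave ξ) (dir ξ) (U t ξ) (A t ξ)) := by
  have hw := continuous_wave (d := d)
  have hV : ∀ k, HasL2Deriv μ (fun t ξ => corrected (wave ξ) (dir ξ) (U t ξ) (A t ξ) k)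
      (fun t ξ => corrected (wave ξ) (dir ξ) (velRate ω (wave ξ) (dir ξ) (U t ξ) (A t ξ))
        (stressRate ω (wave ξ) (dir ξ) (U t ξ) (A t ξ)) k) := fun k =>
    (hU k).add ((HasL2Deriv.transverse hA k).const_mul (c := fun ξ => Complex.I * (wave ξ : ℂ))
      (C := 2 * Real.pi * R) (by fun_prop) (by
        filter_upwards [hR] with ξ hξ
        rw [norm_mul, Complex.norm_I, one_mul]
        exact norm_wave_le hξ))
  have hs : ∀ j k, HasL2Deriv μ (fun t ξ => (wave ξ : ℂ) * A t ξ j k)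
      (fun t ξ => (wave ξ : ℂ) * stressRate ω (wave ξ) (dir ξ) (U t ξ) (A t ξ) j k) :=
    fun j k => (hA j k).const_mul (by fun_prop) (hR.mono fun ξ hξ => norm_wave_le hξ)
  have h := (HasEnergyDeriv.sum Finset.univ fun k _ => (hV k).hasEnergyDeriv).add
    (HasEnergyDeriv.sum Finset.univ fun j _ => HasEnergyDeriv.sum Finset.univ fun k _ =>
      (hs j k).hasEnergyDeriv)
  convert h using 3 with t ξ t ξ
  · rw [lowEnergy]
    simp only [norm_mul, mul_pow, Complex.norm_real, Real.norm_eq_abs, sq_abs, Finset.mul_sum]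
  · rw [lowEnergyRate]
    simp only [Finset.mul_sum]
    congr 1
    refine Finset.sum_congr rfl fun j _ => Finset.sum_congr rfl fun k _ => ?_
    have : ∀ z w : ℂ, (conj ((wave ξ : ℂ) * z) * ((wave ξ : ℂ) * w)).re =
        wave ξ ^ 2 * (conj z * w).re := by
      intro z w
      rw [← Complex.re_ofReal_mul, map_mul, Complex.conj_ofReal]
      push_cast
      ring_nf
    rw [this]
    ring

theorem hasEnergyDeriv_highEnergy
    (hU : ∀ k, HasL2Deriv μ (fun t ξ => U t ξ k)
      (fun t ξ => velRate ω (wave ξ) (dir ξ) (U t ξ) (A t ξ) k))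
    (hA : ∀ j k, HasL2Deriv μ (fun t ξ => A t ξ j k)
      (fun t ξ => stressRate ω (wave ξ) (dir ξ) (U t ξ) (A t ξ) j k)) :
    HasEnergyDeriv μ (fun t ξ => highEnergy ω (dir ξ) (U t ξ) (A t ξ))
      (fun t ξ => highEnergyRate ω (wave ξ) (dir ξ) (U t ξ) (A t ξ)) := by
  have hq : HasL2Deriv μ (fun t ξ => longitudinal (dir ξ) (U t ξ))
      (fun t ξ => longitudinal (dir ξ) (velRate ω (wave ξ) (dir ξ) (U t ξ) (A t ξ))) :=
    HasL2Deriv.sum _ fun k _ => (hU k).const_mul (measurable_dir k).aestronglyMeasurable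
      (Eventually.of_forall fun ξ => norm_dir_le ξ k)
  have ha : ∀ j k, HasL2Deriv μ (fun t ξ => A t ξ j k - A t ξ k j)
      (fun t ξ => stressRate ω (wave ξ) (dir ξ) (U t ξ) (A t ξ) j k -
        stressRate ω (wave ξ) (dir ξ) (U t ξ) (A t ξ) k j) := by
    intro j k
    have := (hA j k).add ((hA k j).const_mul (c := fun _ => -1) (C := 1) (by fun_prop) (by simp))
    simpa only [neg_one_mul, ← sub_eq_add_neg] using this
  exact (((HasEnergyDeriv.sum _ fun k _ => (hU k).hasEnergyDeriv).const_mul ω).add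
    ((hasEnergyDeriv_stress hA).const_mul (1 / 2))).add
    ((hq.hasEnergyDeriv.const_mul (2 / (1 - ω))).add
      ((HasEnergyDeriv.sum _ fun j _ => HasEnergyDeriv.sum _ fun k _ =>
        (ha j k).hasEnergyDeriv).const_mul (1 / (1 - ω))))

end Densities

section DecayCharacter

variable {d : ℕ} {F : Type*} [NormedAddCommGroup F]

theorem integrable_norm_sq_Lp (f : Lp F 2 (volume : Measure (EuclideanSpace ℝ (Fin d)))) :
    Integrable fun ξ => ‖f ξ‖ ^ 2 :=
  (Lp.memLp f).integrable_norm_pow (p := 2) (by norm_num)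

variable [InnerProductSpace ℂ F]

theorem integral_norm_sq_Lp (f : Lp F 2 (volume : Measure (EuclideanSpace ℝ (Fin d)))) :
    ∫ ξ, ‖f ξ‖ ^ 2 = ‖f‖ ^ 2 := by
  rw [← inner_self_eq_norm_sq (𝕜 := ℂ), L2.inner_def, ← integral_re (L2.integrable_inner _ _)]
  simp only [inner_self_eq_norm_sq (𝕜 := ℂ)]

variable [CompleteSpace F]

theorem integral_norm_sq_fourier_Lp
    (v : Lp F 2 (volume : Measure (EuclideanSpace ℝ (Fin d)))) :
    ∫ ξ, ‖(𝓕 v) ξ‖ ^ 2 = ‖v‖ ^ 2 := by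
  rw [integral_norm_sq_Lp, Lp.norm_fourier_eq]

/-- The low frequency mass of a function with decay character `r` is at most a multiple of
`ρ ^ (2 r + d)`. -/
theorem IsDecayCharacter.exists_le {v : Lp F 2 (volume : Measure (EuclideanSpace ℝ (Fin d)))}
    {r : ℝ} (h : IsDecayCharacter v r) :
    ∃ C : ℝ, 0 ≤ C ∧ ∀ ρ, 0 < ρ → ρ ≤ 1 →
      ∫ ξ in Metric.ball (0 : EuclideanSpace ℝ (Fin d)) ρ, ‖(𝓕 v) ξ‖ ^ 2 ≤
        C * ρ ^ (2 * r + d) := by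
  obtain ⟨hr, P, hP, hlim⟩ := h
  have hev := hlim.eventually (gt_mem_nhds (lt_add_one P))
  obtain ⟨δ, hδ, hsub⟩ := mem_nhdsGT_iff_exists_Ioo_subset.1 hev
  have hδ0 : (0 : ℝ) < δ := hδ
  have ha : 0 < 2 * r + d := by linarith
  refine ⟨P + 1 + ‖v‖ ^ 2 * (δ ^ (2 * r + d))⁻¹, by positivity, fun ρ hρ hρ1 => ?_⟩
  have hpos : 0 < ρ ^ (2 * r + d) := Real.rpow_pos_of_pos hρ _
  rcases lt_or_ge ρ δ with hlt | hge
  · have h1 : ρ ^ (-2 * r - (d : ℝ)) * _ < P + 1 := hsub ⟨hρ, hlt⟩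
    rw [show -2 * r - (d : ℝ) = -(2 * r + d) by ring, Real.rpow_neg hρ.le,
      inv_mul_lt_iff₀ hpos] at h1
    refine h1.le.trans ?_
    rw [mul_comm]
    exact mul_le_mul_of_nonneg_right (le_add_of_nonneg_right (by positivity)) hpos.le
  · calc ∫ ξ in Metric.ball (0 : EuclideanSpace ℝ (Fin d)) ρ, ‖(𝓕 v) ξ‖ ^ 2
        ≤ ∫ ξ, ‖(𝓕 v) ξ‖ ^ 2 :=
          setIntegral_le_integral (integrable_norm_sq_Lp (𝓕 v))
            (Eventually.of_forall fun ξ => sq_nonneg ‖(𝓕 v) ξ‖)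
      _ = ‖v‖ ^ 2 * ((δ ^ (2 * r + d))⁻¹ * δ ^ (2 * r + d)) := by
          rw [integral_norm_sq_fourier_Lp, inv_mul_cancel₀ (Real.rpow_pos_of_pos hδ0 _).ne', mul_one]
      _ ≤ ‖v‖ ^ 2 * ((δ ^ (2 * r + d))⁻¹ * ρ ^ (2 * r + d)) := by gcongr
      _ ≤ _ := by
          rw [← mul_assoc]
          exact mul_le_mul_of_nonneg_right (le_add_of_nonneg_left (by positivity)) hpos.le

end DecayCharacter

section Solution

variable {d : ℕ} {ω r : ℝ} {u₀ : VecL2 d} {τ₀ : MatL2 d} {u : ℝ → VecL2 d} {τ : ℝ → MatL2 d}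

/-- The components of the Fourier transform of a vector field. -/
def vecHat (u : VecL2 d) (ξ : EuclideanSpace ℝ (Fin d)) (k : Fin d) : ℂ := (𝓕 u) ξ k

/-- The components of the Fourier transform of a matrix field. -/
def matHat (τ : MatL2 d) (ξ : EuclideanSpace ℝ (Fin d)) (j k : Fin d) : ℂ := (𝓕 τ) ξ (j, k)

theorem sum_norm_vecHat_sq (u : VecL2 d) (ξ : EuclideanSpace ℝ (Fin d)) :
    ∑ k, ‖vecHat u ξ k‖ ^ 2 = ‖(𝓕 u) ξ‖ ^ 2 :=
  (EuclideanSpace.norm_sq_eq _).symm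

theorem sum_norm_matHat_sq (τ : MatL2 d) (ξ : EuclideanSpace ℝ (Fin d)) :
    ∑ j, ∑ k, ‖matHat τ ξ j k‖ ^ 2 = ‖(𝓕 τ) ξ‖ ^ 2 := by
  rw [EuclideanSpace.norm_sq_eq, Fintype.sum_prod_type]
  rfl

/-- The low frequency energy of the fields `u`, `τ` in the ball of radius `ρ`. -/
def lowMass (ρ : ℝ) (u : VecL2 d) (τ : MatL2 d) : ℝ :=
  ∫ ξ in Metric.ball 0 ρ, lowEnergy (wave ξ) (dir ξ) (vecHat u ξ) (matHat τ ξ)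

theorem lowEnergy_nonneg {s : ℝ} {θ : Fin d → ℝ} (u : Fin d → ℂ) (A : Fin d → Fin d → ℂ) :
    0 ≤ lowEnergy s θ u A := by
  unfold lowEnergy; positivity

theorem wave_le_of_mem_ball (hr : r ≤ (1 - ω) / (12 * Real.pi)) {ξ : EuclideanSpace ℝ (Fin d)}
    (hξ : ξ ∈ Metric.ball 0 r) : wave ξ ≤ (1 - ω) / 6 := by
  rw [mem_ball_zero_iff] at hξ
  have h1 : ‖ξ‖ ≤ (1 - ω) / (12 * Real.pi) := hξ.le.trans hr
  rw [le_div_iff₀ (by positivity)] at h1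
  rw [wave]
  linarith

theorem IsSolution.hasEnergyDeriv_lowEnergy (h : IsSolution ω u₀ τ₀ u τ) (r : ℝ) :
    HasEnergyDeriv (volume.restrict (Metric.ball 0 r))
      (fun t ξ => lowEnergy (wave ξ) (dir ξ) (vecHat (u t) ξ) (matHat (τ t) ξ))
      (fun t ξ => lowEnergyRate ω (wave ξ) (dir ξ) (vecHat (u t) ξ) (matHat (τ t) ξ)) :=
  OldroydB.hasEnergyDeriv_lowEnergy (μ := volume.restrict (Metric.ball 0 r)) (R := r) (ω := ω)
    (U := fun t => vecHat (u t)) (A := fun t => matHat (τ t))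
    ((ae_restrict_mem measurableSet_ball).mono fun _ hξ => (mem_ball_zero_iff.1 hξ).le)
    (fun k => h.hasL2Deriv_velocity k measurableSet_ball (R := r)
      fun _ hξ => (mem_ball_zero_iff.1 hξ).le)
    (fun j k => h.hasL2Deriv_stress j k measurableSet_ball (R := r)
      fun _ hξ => (mem_ball_zero_iff.1 hξ).le)

/-- The low frequency energy below any small radius does not increase. -/
theorem IsSolution.lowMass_le_initial (h : IsSolution ω u₀ τ₀ u τ) (hd : 1 ≤ d) (hω : 0 ≤ ω)
    (hω₁ : ω ≤ 1) (hr : r ≤ (1 - ω) / (12 * Real.pi)) {t : ℝ} (ht : 0 ≤ t) :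
    lowMass r (u t) (τ t) ≤ lowMass r u₀ τ₀ := by
  have he := h.hasEnergyDeriv_lowEnergy r
  refine le_of_deriv_le_of_lt (f := fun t => lowMass r (u t) (τ t))
    (g := fun _ => lowMass r u₀ τ₀) (g' := fun _ => 0) he.continuousOn continuousOn_const
    he.hasDerivAt (fun t _ => hasDerivAt_const t _) ?_ (fun t _ _ => ?_) ht
  · simp only [h.initial_velocity, h.initial_stress, le_refl]
  · refine integral_nonpos_of_ae ?_
    filter_upwards [ae_restrict_of_ae (ae_sum_dir_sq hd), ae_restrict_mem measurableSet_ball]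
      with ξ hξ hmem
    refine (lowEnergyRate_le hω hω₁ (wave_nonneg ξ) (wave_le_of_mem_ball hr hmem) hξ _ _).trans ?_
    have := lowEnergy_nonneg (s := wave ξ) (θ := dir ξ) (vecHat (u t) ξ) (matHat (τ t) ξ)
    have h1 : 0 ≤ 1 - ω := by linarith
    exact neg_nonpos.2 (by positivity)

theorem lowMass_initial_le {ru rτ Cu Cτ p : ℝ} (hd : 1 ≤ d)
    (hCu : 0 ≤ Cu) (hCτ : 0 ≤ Cτ)
    (hu : ∀ ρ, 0 < ρ → ρ ≤ 1 → ∫ ξ in Metric.ball (0 : EuclideanSpace ℝ (Fin d)) ρ,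
      ‖(𝓕 u₀) ξ‖ ^ 2 ≤ Cu * ρ ^ (2 * ru + d))
    (hτ : ∀ ρ, 0 < ρ → ρ ≤ 1 → ∫ ξ in Metric.ball (0 : EuclideanSpace ℝ (Fin d)) ρ,
      ‖(𝓕 τ₀) ξ‖ ^ 2 ≤ Cτ * ρ ^ (2 * rτ + d))
    (hpu : 2 * p ≤ 2 * ru + d) (hpτ : 2 * p ≤ 2 + (2 * rτ + d)) {ρ : ℝ} (hρ : 0 < ρ)
    (hρ1 : ρ ≤ 1) :
    lowMass ρ u₀ τ₀ ≤ (2 * Cu + 3 * (2 * Real.pi) ^ 2 * Cτ) * ρ ^ (2 * p) := by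
  have hi : Integrable (fun ξ => 2 * ‖(𝓕 u₀) ξ‖ ^ 2 +
      3 * (2 * Real.pi * ρ) ^ 2 * ‖(𝓕 τ₀) ξ‖ ^ 2) :=
    ((integrable_norm_sq_Lp _).const_mul _).add ((integrable_norm_sq_Lp _).const_mul _)
  have h1 : lowMass ρ u₀ τ₀ ≤ ∫ ξ in Metric.ball (0 : EuclideanSpace ℝ (Fin d)) ρ,
      (2 * ‖(𝓕 u₀) ξ‖ ^ 2 + 3 * (2 * Real.pi * ρ) ^ 2 * ‖(𝓕 τ₀) ξ‖ ^ 2) := by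
    refine integral_mono_of_nonneg (Eventually.of_forall fun ξ => lowEnergy_nonneg _ _)
      hi.integrableOn ?_
    filter_upwards [ae_restrict_of_ae (ae_sum_dir_sq hd), ae_restrict_mem measurableSet_ball]
      with ξ hξ hmem
    have h2 := sum_norm_corrected_sq_le (s := wave ξ) hξ (vecHat u₀ ξ) (matHat τ₀ ξ)
    rw [lowEnergy]
    rw [sum_norm_matHat_sq, sum_norm_vecHat_sq] at h2
    rw [sum_norm_matHat_sq]
    have h3 : wave ξ ^ 2 ≤ (2 * Real.pi * ρ) ^ 2 := by
      refine pow_le_pow_left₀ (wave_nonneg ξ) ?_ 2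
      rw [wave]
      have := (mem_ball_zero_iff.1 hmem).le
      gcongr
    have h4 := mul_le_mul_of_nonneg_right h3 (sq_nonneg ‖(𝓕 τ₀) ξ‖)
    linarith
  refine h1.trans ?_
  rw [integral_add ((integrable_norm_sq_Lp _).const_mul _).integrableOn
    ((integrable_norm_sq_Lp _).const_mul _).integrableOn, integral_const_mul, integral_const_mul]
  have h5 : Cu * ρ ^ (2 * ru + d) ≤ Cu * ρ ^ (2 * p) :=
    mul_le_mul_of_nonneg_left (Real.rpow_le_rpow_of_exponent_ge hρ hρ1 hpu) hCu
  have h6 : ρ ^ 2 * (Cτ * ρ ^ (2 * rτ + d)) ≤ Cτ * ρ ^ (2 * p) := by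
    rw [mul_left_comm, ← Real.rpow_two, ← Real.rpow_add hρ]
    exact mul_le_mul_of_nonneg_left (Real.rpow_le_rpow_of_exponent_ge hρ hρ1 hpτ) hCτ
  have h7 := mul_le_mul_of_nonneg_left (hτ ρ hρ hρ1)
    (show 0 ≤ 3 * (2 * Real.pi * ρ) ^ 2 by positivity)
  have h8 := mul_le_mul_of_nonneg_left h6 (show 0 ≤ 3 * (2 * Real.pi) ^ 2 by positivity)
  have h9 := hu ρ hρ hρ1
  nlinarith

theorem IsSolution.lowMass_le (h : IsSolution ω u₀ τ₀ u τ) (hd : 1 ≤ d) (hω : 0 ≤ ω)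
    (hω₁ : ω < 1) (hr0 : 0 < r) (hr : r ≤ (1 - ω) / (12 * Real.pi)) {B K L p : ℝ} (hK : 0 < K)
    (hp : 0 < p)
    (hinit : ∀ ρ, 0 < ρ → ρ ≤ r → lowMass ρ u₀ τ₀ ≤ B * ρ ^ (2 * p))
    (hKr : p + 1 ≤ (1 - ω) * (2 * Real.pi) ^ 2 * r ^ 2 * K)
    (hB : (p + 1) * (B * ((p + 1) / ((1 - ω) * (2 * Real.pi) ^ 2)) ^ p) ≤ L)
    (h0 : lowMass r u₀ τ₀ ≤ L * K ^ (-p)) {t : ℝ} (ht : 0 ≤ t) :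
    lowMass r (u t) (τ t) ≤ L * (K + t) ^ (-p) := by
  have hb : 0 < 1 - ω := by linarith
  have he := h.hasEnergyDeriv_lowEnergy r
  refine le_mul_rpow_of_splitting (N := fun t => lowMass r (u t) (τ t)) he.continuousOn
    he.hasDerivAt (by positivity : 0 < (1 - ω) * (2 * Real.pi) ^ 2) hr0 hK hp ?_ hKr hB
    (by simpa only [h.initial_velocity, h.initial_stress] using h0) ht
  intro t ht ρ hρ hρr
  set e := fun ξ => lowEnergy (wave ξ) (dir ξ) (vecHat (u t) ξ) (matHat (τ t) ξ) with he_def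
  have hei : IntegrableOn e (Metric.ball 0 r) := he.integrable t ht.le
  have hlow : ∫ ξ in Metric.ball 0 r, (Metric.ball 0 ρ).indicator e ξ =
      lowMass ρ (u t) (τ t) := by
    rw [setIntegral_indicator measurableSet_ball,
      Set.inter_eq_right.2 (Metric.ball_subset_ball hρr)]
    rfl
  have h1 : lowMass ρ (u t) (τ t) ≤ B * ρ ^ (2 * p) :=
    (h.lowMass_le_initial hd hω hω₁.le (hρr.trans hr) ht.le).trans (hinit ρ hρ hρr)
  calc _ ≤ ∫ ξ in Metric.ball 0 r, -((1 - ω) * (2 * Real.pi) ^ 2 * ρ ^ 2) *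
        (e ξ - (Metric.ball 0 ρ).indicator e ξ) := by
        refine integral_mono_ae (he.integrable_deriv t ht)
          ((hei.sub (hei.indicator measurableSet_ball)).const_mul _) ?_
        filter_upwards [ae_restrict_of_ae (ae_sum_dir_sq hd),
          ae_restrict_mem measurableSet_ball] with ξ hξ hmem
        have h2 := lowEnergyRate_le hω hω₁.le (wave_nonneg ξ) (wave_le_of_mem_ball hr hmem) hξ
          (vecHat (u t) ξ) (matHat (τ t) ξ)
        refine h2.trans ?_
        have h3 : 0 ≤ e ξ := lowEnergy_nonneg _ _
        by_cases hin : ξ ∈ Metric.ball (0 : EuclideanSpace ℝ (Fin d)) ρ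
        · rw [Set.indicator_of_mem hin, sub_self, mul_zero]
          exact neg_nonpos.2 (by positivity)
        · rw [Set.indicator_of_notMem hin, sub_zero, neg_mul, neg_le_neg_iff]
          rw [mem_ball_zero_iff, not_lt] at hin
          have h4 : (2 * Real.pi) ^ 2 * ρ ^ 2 ≤ wave ξ ^ 2 := by
            rw [wave, ← mul_pow]
            gcongr
          rw [mul_assoc (1 - ω)]
          exact mul_le_mul_of_nonneg_right (mul_le_mul_of_nonneg_left h4 hb.le) h3
    _ = -((1 - ω) * (2 * Real.pi) ^ 2 * ρ ^ 2 *
        (lowMass r (u t) (τ t) - lowMass ρ (u t) (τ t))) := by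
        rw [integral_const_mul, integral_sub hei (hei.indicator measurableSet_ball), hlow, neg_mul]
        rfl
    _ ≤ _ := by
        rw [neg_le_neg_iff]
        gcongr

/-- Below the radius `r` the stress relaxes at rate `1` towards the low frequency energy. -/
theorem IsSolution.low_stress_le (h : IsSolution ω u₀ τ₀ u τ) (hd : 1 ≤ d) (hω : 0 ≤ ω)
    (hω₁ : ω ≤ 1) (hr : r ≤ (1 - ω) / (12 * Real.pi)) {K L L' p : ℝ} (hK : 0 < K)
    (hL' : 0 ≤ L')
    (hlow : ∀ t, 0 ≤ t → lowMass r (u t) (τ t) ≤ L * (K + t) ^ (-p))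
    (hpK : 2 * p ≤ K) (hL : 2 * L ≤ L') (h0 : ‖τ₀‖ ^ 2 ≤ L' * K ^ (-p)) {t : ℝ} (ht : 0 ≤ t) :
    ∫ ξ in Metric.ball (0 : EuclideanSpace ℝ (Fin d)) r, ‖(𝓕 (τ t)) ξ‖ ^ 2 ≤
      L' * (K + t) ^ (-p) := by
  have he := h.hasEnergyDeriv_lowEnergy r
  have hs := hasEnergyDeriv_stress (μ := volume.restrict (Metric.ball 0 r)) (ω := ω)
    (U := fun t => vecHat (u t)) (A := fun t => matHat (τ t))
    (fun j k => h.hasL2Deriv_stress j k measurableSet_ball (R := r)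
      fun _ hξ => (mem_ball_zero_iff.1 hξ).le)
  have hM := le_mul_rpow_of_deriv_le_damped (c := 1) (B := L) hs.continuousOn hs.hasDerivAt one_pos
    hK hL' (p := p) ?_ (by linarith) (by linarith) ?_ ht
  · simpa only [sum_norm_matHat_sq] using hM
  · intro t ht
    calc _ ≤ ∫ ξ in Metric.ball 0 r, (-(∑ j, ∑ k, ‖matHat (τ t) ξ j k‖ ^ 2) +
          lowEnergy (wave ξ) (dir ξ) (vecHat (u t) ξ) (matHat (τ t) ξ)) := by
          refine integral_mono_ae (hs.integrable_deriv t ht)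
            ((hs.integrable t ht.le).neg.add (he.integrable t ht.le)) ?_
          filter_upwards [ae_restrict_of_ae (ae_sum_dir_sq hd),
            ae_restrict_mem measurableSet_ball] with ξ hξ hmem
          exact stress_energy_rate_le_of_low hω hω₁ (wave_nonneg ξ) (wave_le_of_mem_ball hr hmem) hξ _ _
      _ = -(1 * ∫ ξ in Metric.ball 0 r, ∑ j, ∑ k, ‖matHat (τ t) ξ j k‖ ^ 2) +
          lowMass r (u t) (τ t) := by
          rw [one_mul, ← integral_neg]
          exact integral_add (hs.integrable t ht.le).neg (he.integrable t ht.le)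
      _ ≤ _ := add_le_add_right (hlow t ht.le) _
  · simp only [sum_norm_matHat_sq, h.initial_stress]
    refine le_trans ?_ h0
    rw [← integral_norm_sq_fourier_Lp]
    exact setIntegral_le_integral (integrable_norm_sq_Lp _)
      (Eventually.of_forall fun ξ => by positivity)

/-- The density of the energy `ω ‖u‖² + ‖τ‖² / 2` in frequency space. -/
def energyDensity (ω : ℝ) (u : VecL2 d) (τ : MatL2 d) (ξ : EuclideanSpace ℝ (Fin d)) : ℝ :=
  ω * ‖(𝓕 u) ξ‖ ^ 2 + 1 / 2 * ‖(𝓕 τ) ξ‖ ^ 2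

theorem integrable_energyDensity (ω : ℝ) (u : VecL2 d) (τ : MatL2 d) :
    Integrable (energyDensity ω u τ) :=
  ((integrable_norm_sq_Lp _).const_mul _).add ((integrable_norm_sq_Lp _).const_mul _)

theorem integral_energyDensity (ω : ℝ) (u : VecL2 d) (τ : MatL2 d) :
    ∫ ξ, energyDensity ω u τ ξ = ω * ‖u‖ ^ 2 + 1 / 2 * ‖τ‖ ^ 2 := by
  unfold energyDensity
  rw [integral_add ((integrable_norm_sq_Lp _).const_mul _) ((integrable_norm_sq_Lp _).const_mul _),
    integral_const_mul, integral_const_mul, integral_norm_sq_fourier_Lp,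
    integral_norm_sq_fourier_Lp]

/-- Decay of the energy at frequencies between `r` and `R`, uniformly in `R`. -/
theorem IsSolution.annulus_energy_le (h : IsSolution ω u₀ τ₀ u τ) (hd : 1 ≤ d) (hω : 0 < ω)
    (hω₁ : ω < 1) (hr0 : 0 ≤ r) (hr1 : 2 * Real.pi * r ≤ 1) (R : ℝ) {K L p : ℝ} (hK : 0 < K)
    (hL : 0 ≤ L) (hpK : 2 * p ≤ (1 - ω) * (2 * Real.pi * r) ^ 2 * K)
    (hc : 0 < (1 - ω) * (2 * Real.pi * r) ^ 2)
    (h0 : 5 / (1 - ω) * (‖u₀‖ ^ 2 + ‖τ₀‖ ^ 2) ≤ L * K ^ (-p)) {t : ℝ} (ht : 0 ≤ t) :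
    ∫ ξ in Metric.ball 0 R \ Metric.ball 0 r, energyDensity ω (u t) (τ t) ξ ≤
      L * (K + t) ^ (-p) := by
  set S : Set (EuclideanSpace ℝ (Fin d)) := Metric.ball 0 R \ Metric.ball 0 r with hS
  have hSm : MeasurableSet S := measurableSet_ball.diff measurableSet_ball
  have hSR : ∀ ξ ∈ S, ‖ξ‖ ≤ R := fun ξ hξ => (mem_ball_zero_iff.1 hξ.1).le
  have hb : 0 < 1 - ω := by linarith
  have he := hasEnergyDeriv_highEnergy (μ := volume.restrict S) (ω := ω)
    (U := fun t => vecHat (u t)) (A := fun t => matHat (τ t))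
    (fun k => h.hasL2Deriv_velocity k hSm hSR) (fun j k => h.hasL2Deriv_stress j k hSm hSR)
  have h1 : ∫ ξ in S, energyDensity ω (u t) (τ t) ξ ≤
      ∫ ξ in S, highEnergy ω (dir ξ) (vecHat (u t) ξ) (matHat (τ t) ξ) := by
    refine integral_mono (integrable_energyDensity _ _ _).integrableOn (he.integrable t ht)
      fun ξ => ?_
    have h2 := energy_le_highEnergy (θ := dir ξ) hω₁ (vecHat (u t) ξ) (matHat (τ t) ξ)
    rwa [sum_norm_vecHat_sq, sum_norm_matHat_sq] at h2
  refine h1.trans (le_mul_rpow_of_deriv_le_damped (B := 0) he.continuousOn he.hasDerivAt hc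
    hK hL (p := p) (fun t ht => ?_) hpK (by rw [mul_zero]; positivity) ?_ ht)
  · rw [zero_mul, add_zero, ← integral_const_mul, ← integral_neg]
    refine integral_mono_ae (he.integrable_deriv t ht)
      ((he.integrable t ht.le).const_mul _).neg ?_
    filter_upwards [ae_restrict_of_ae (ae_sum_dir_sq hd), ae_restrict_mem hSm] with ξ hξ hmem
    refine highEnergyRate_le_neg_mul hω hω₁ (by positivity) ?_ hr1 hξ _ _
    have h2 := hmem.2
    rw [mem_ball_zero_iff, not_lt] at h2
    rw [wave]
    gcongr
  · simp only [h.initial_velocity, h.initial_stress]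
    have hi : Integrable fun ξ => ‖(𝓕 u₀) ξ‖ ^ 2 + ‖(𝓕 τ₀) ξ‖ ^ 2 :=
      (integrable_norm_sq_Lp _).add (integrable_norm_sq_Lp _)
    calc _ ≤ ∫ ξ in S, 5 / (1 - ω) * (‖(𝓕 u₀) ξ‖ ^ 2 + ‖(𝓕 τ₀) ξ‖ ^ 2) := by
          refine integral_mono_of_nonneg (Eventually.of_forall fun ξ => ?_)
            (hi.const_mul _).integrableOn ?_
          · unfold highEnergy
            exact add_nonneg (by positivity) (by positivity)
          · filter_upwards [ae_restrict_of_ae (ae_sum_dir_sq hd)] with ξ hξ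
            have h2 := highEnergy_le hω hω₁ hξ (vecHat u₀ ξ) (matHat τ₀ ξ)
            rwa [sum_norm_vecHat_sq, sum_norm_matHat_sq] at h2
      _ ≤ ∫ ξ, 5 / (1 - ω) * (‖(𝓕 u₀) ξ‖ ^ 2 + ‖(𝓕 τ₀) ξ‖ ^ 2) :=
          setIntegral_le_integral (hi.const_mul _) (Eventually.of_forall fun ξ => by positivity)
      _ = 5 / (1 - ω) * (‖u₀‖ ^ 2 + ‖τ₀‖ ^ 2) := by
          rw [integral_const_mul, integral_add (integrable_norm_sq_Lp _) (integrable_norm_sq_Lp _),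
            integral_norm_sq_fourier_Lp, integral_norm_sq_fourier_Lp]
      _ ≤ _ := h0

theorem setIntegral_compl_ball_le {f : EuclideanSpace ℝ (Fin d) → ℝ} (hf : Integrable f) {C : ℝ}
    (h : ∀ R : ℝ, ∫ ξ in Metric.ball 0 R \ Metric.ball 0 r, f ξ ≤ C) :
    ∫ ξ in (Metric.ball 0 r)ᶜ, f ξ ≤ C := by
  have hU : ⋃ n : ℕ, (Metric.ball (0 : EuclideanSpace ℝ (Fin d)) (n : ℝ) \ Metric.ball 0 r) =
      (Metric.ball 0 r)ᶜ := by
    rw [← Set.iUnion_sdiff, Metric.iUnion_ball_nat, Set.compl_eq_univ_sdiff]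
  have := tendsto_setIntegral_of_monotone (μ := volume) (f := f)
    (s := fun n : ℕ => Metric.ball (0 : EuclideanSpace ℝ (Fin d)) (n : ℝ) \ Metric.ball 0 r)
    (fun n => measurableSet_ball.diff measurableSet_ball)
    (fun m n hmn => Set.sdiff_subset_sdiff_left (Metric.ball_subset_ball (by exact_mod_cast hmn)))
    hf.integrableOn
  rw [hU] at this
  exact le_of_tendsto' this fun n => h n

theorem setIntegral_ball_energyDensity_le (hd : 1 ≤ d) (hω₁ : ω ≤ 1) (u : VecL2 d) (τ : MatL2 d)
    (hint : IntegrableOn (fun ξ => lowEnergy (wave ξ) (dir ξ) (vecHat u ξ) (matHat τ ξ))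
      (Metric.ball 0 r)) :
    ∫ ξ in Metric.ball 0 r, energyDensity ω u τ ξ ≤
      2 * lowMass r u τ + 1 / 2 * ∫ ξ in Metric.ball (0 : EuclideanSpace ℝ (Fin d)) r,
        ‖(𝓕 τ) ξ‖ ^ 2 := by
  rw [lowMass, ← integral_const_mul, ← integral_const_mul,
    ← integral_add (hint.const_mul _) ((integrable_norm_sq_Lp _).const_mul _).integrableOn]
  refine integral_mono_ae (integrable_energyDensity _ _ _).integrableOn
    ((hint.const_mul _).add ((integrable_norm_sq_Lp _).const_mul _).integrableOn) ?_
  filter_upwards [ae_restrict_of_ae (ae_sum_dir_sq hd)] with ξ hξ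
  have h1 := sum_norm_velocity_sq_le (s := wave ξ) hξ (vecHat u ξ) (matHat τ ξ)
  have h2 := lowEnergy_nonneg (s := wave ξ) (θ := dir ξ) (vecHat u ξ) (matHat τ ξ)
  simp only [energyDensity]
  rw [sum_norm_vecHat_sq] at h1
  have h3 : ‖(𝓕 u) ξ‖ ^ 2 ≤
      2 * lowEnergy (wave ξ) (dir ξ) (vecHat u ξ) (matHat τ ξ) := by
    rw [lowEnergy]
    linarith
  nlinarith

end Solution

end

end OldroydB

open OldroydB MeasureTheory

theorem proposition3p3 (d : ℕ) (hd : 1 ≤ d) (ω : ℝ) (hω₀ : 0 < ω) (hω₁ : ω < 1)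
    (u₀ : OldroydB.VecL2 d) (τ₀ : OldroydB.MatL2 d) (ru rτ : ℝ)
    (hu : OldroydB.IsDecayCharacter u₀ ru) (hτ : OldroydB.IsDecayCharacter τ₀ rτ) :
    ∃ C : ℝ, 0 < C ∧ ∀ (u : ℝ → OldroydB.VecL2 d) (τ : ℝ → OldroydB.MatL2 d),
      OldroydB.IsSolution ω u₀ τ₀ u τ → ∀ t : ℝ, 0 < t →
        ω * ‖u t‖ ^ 2 + 1 / 2 * ‖τ t‖ ^ 2 ≤
          C * (1 + t) ^ (-((d : ℝ) / 2 + min ru (1 + rτ))) := by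
  obtain ⟨Cu, hCu, hCu'⟩ := hu.exists_le
  obtain ⟨Cτ, hCτ, hCτ'⟩ := hτ.exists_le
  set p := (d : ℝ) / 2 + min ru (1 + rτ) with hp_def
  have hpu : 2 * p ≤ 2 * ru + d := by linarith [min_le_left ru (1 + rτ)]
  have hpτ : 2 * p ≤ 2 + (2 * rτ + d) := by linarith [min_le_right ru (1 + rτ)]
  have hp : 0 < p := by
    have := lt_min hu.1 (show -(d : ℝ) / 2 < 1 + rτ by linarith [hτ.1])
    linarith
  have hb : 0 < 1 - ω := by linarith
  -- the cut-off radius corresponds to the wave number `2πr = (1 - ω) / 6`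
  set r := (1 - ω) / (12 * Real.pi) with hr
  have hr0 : 0 < r := by positivity
  have hr6 : 2 * Real.pi * r = (1 - ω) / 6 := by
    rw [hr]; field_simp; ring
  have hr1 : r ≤ 1 := by
    rw [hr, div_le_one (by positivity)]
    linarith [Real.pi_gt_three]
  set B := 2 * Cu + 3 * (2 * Real.pi) ^ 2 * Cτ with hB
  have hB0 : 0 ≤ B := by positivity
  set c := (1 - ω) * (2 * Real.pi * r) ^ 2 with hc
  have hc0 : 0 < c := by positivity
  -- the shift in time makes every rate of damping large compared with `p / (K + t)`
  set K := 1 + (p + 1) / c + 2 * p + 2 * p / c with hK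
  have hd1 : 0 ≤ (p + 1) / c := by positivity
  have hd2 : 0 ≤ 2 * p / c := by positivity
  have hK1 : 1 ≤ K := by linarith
  have hK0 : 0 < K := by linarith
  have hKp : 0 < K ^ p := Real.rpow_pos_of_pos hK0 p
  have hKK : K ^ p * K ^ (-p) = 1 := by
    rw [← Real.rpow_add hK0, add_neg_cancel, Real.rpow_zero]
  have hXK : 0 < K ^ (-p) := Real.rpow_pos_of_pos hK0 _
  have hKc : p + 1 ≤ c * K := by
    have h1 : c * ((p + 1) / c) ≤ c * K := mul_le_mul_of_nonneg_left (by linarith) hc0.le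
    rwa [mul_div_cancel₀ _ hc0.ne'] at h1
  have hKc' : 2 * p ≤ c * K := by
    have h1 : c * (2 * p / c) ≤ c * K := mul_le_mul_of_nonneg_left (by linarith) hc0.le
    rwa [mul_div_cancel₀ _ hc0.ne'] at h1
  set L₁ := (p + 1) * (B * ((p + 1) / ((1 - ω) * (2 * Real.pi) ^ 2)) ^ p) +
    B * r ^ (2 * p) * K ^ p with hL₁
  have hL₁a : 0 ≤ (p + 1) * (B * ((p + 1) / ((1 - ω) * (2 * Real.pi) ^ 2)) ^ p) := by positivity
  have hL₁b : 0 ≤ B * r ^ (2 * p) * K ^ p := by positivity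
  have hL₁0 : 0 ≤ L₁ := by linarith
  set L₂ := 2 * L₁ + ‖τ₀‖ ^ 2 * K ^ p with hL₂
  have hL₂0 : 0 ≤ L₂ := by positivity
  set L₃ := 5 / (1 - ω) * (‖u₀‖ ^ 2 + ‖τ₀‖ ^ 2) * K ^ p with hL₃
  have hL₃0 : 0 ≤ L₃ := by positivity
  refine ⟨2 * L₁ + 1 / 2 * L₂ + L₃ + 1, by positivity, fun u τ h t ht => ?_⟩
  have hinit : ∀ ρ, 0 < ρ → ρ ≤ r → lowMass ρ u₀ τ₀ ≤ B * ρ ^ (2 * p) := fun ρ hρ hρr =>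
    lowMass_initial_le hd hCu hCτ hCu' hCτ' hpu hpτ hρ (hρr.trans hr1)
  have hlow : ∀ t, 0 ≤ t → lowMass r (u t) (τ t) ≤ L₁ * (K + t) ^ (-p) := fun t ht =>
    h.lowMass_le hd hω₀.le hω₁ hr0 hr.le hK0 hp hinit (by rwa [mul_assoc (1 - ω), ← mul_pow])
      (by linarith) (by
        refine (hinit r hr0 le_rfl).trans ?_
        calc B * r ^ (2 * p) = B * r ^ (2 * p) * K ^ p * K ^ (-p) := by
              rw [mul_assoc _ (K ^ p), hKK, mul_one]
          _ ≤ _ := mul_le_mul_of_nonneg_right (by linarith) hXK.le) ht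
  have hstress := h.low_stress_le hd hω₀.le hω₁.le hr.le hK0 hL₂0 hlow (by linarith)
    (le_add_of_nonneg_right (by positivity)) (by
      calc ‖τ₀‖ ^ 2 = ‖τ₀‖ ^ 2 * K ^ p * K ^ (-p) := by rw [mul_assoc, hKK, mul_one]
        _ ≤ _ := mul_le_mul_of_nonneg_right (by linarith) hXK.le) ht.le
  have hhigh := setIntegral_compl_ball_le (r := r) (integrable_energyDensity ω (u t) (τ t))
    fun R => h.annulus_energy_le hd hω₀ hω₁ hr0.le (by linarith) R hK0 hL₃0 hKc' hc0
      (by rw [hL₃, mul_assoc _ (K ^ p), hKK, mul_one]) ht.le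
  have hsplit := setIntegral_ball_energyDensity_le hd hω₁.le (u t) (τ t)
    ((h.hasEnergyDeriv_lowEnergy r).integrable t ht.le)
  rw [← integral_energyDensity, ← integral_add_compl (measurableSet_ball (x := 0) (ε := r))
    (integrable_energyDensity ω (u t) (τ t))]
  have hX : (K + t) ^ (-p) ≤ (1 + t) ^ (-p) :=
    Real.rpow_le_rpow_of_nonpos (by positivity) (by linarith) (by linarith)
  calc _ ≤ (2 * L₁ + 1 / 2 * L₂ + L₃) * (K + t) ^ (-p) := by linarith [hlow t ht.le]
    _ ≤ (2 * L₁ + 1 / 2 * L₂ + L₃) * (1 + t) ^ (-p) := by gcongr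
    _ ≤ _ := mul_le_mul_of_nonneg_right (le_add_of_nonneg_right zero_le_one)
        (Real.rpow_nonneg (by linarith) _)
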